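/- The brushing game on a finite simple graph $G$ is played by two players, Min and Max. Initially every vertex is dirty and there are no brushes. A dirty vertex that holds at least as many brushes as it has dirty neighbours fires: it sends one brush to each dirty neighbour and becomes clean. Vertices fire one after another until no dirty vertex is ready to fire (the order does not affect which vertices become clean or the number of brushes on the dirty vertices). This is done at the start and after each turn. The players alternate turns; on each turn a player adds one brush to a dirty vertex of his or her choice. The game ends when all vertices are clean. Min wants to minimize and Max to maximize the number of turns. The game brush number $b_g(G)$ is the number of turns when Min plays first and both play optimally. Let $\mathcal G(n,p)$ be the binomial random graph on $n$ labelled vertices, in which each pair of vertices is an edge independently with probability $p$. **Theorem.** Let $p=p(n)\in[0,1]$ satisfy $p\gg \ln n/n$, that is, $(\ln n/n)/p(n)\to 0$ as $n\to\infty$, and let $G\in\mathcal G(n,p)$. Then asymptotically almost surely $$b_g(G)=(1+o(1))\,p\,b_g(K_n)=(1+o(1))\,\frac{p\,n^2}{e}.$$ That is, $p\,b_g(K_n)=(1+o(1))\,pn^2/e$ as $n\to\infty$, and for every $\varepsilon>0$, as $n\to\infty$, $$\Pr\bigl(|b_g(G)-p\,b_g(K_n)|\le\varepsilon\,p\,b_g(K_n)\bigr)\to1\quad\text{and}\quad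 \Pr\bigl(|b_g(G)-pn^2/e|\le\varepsilon\, pn^2/e\bigr)\to1.$$ -/

import Mathlib

namespace Brushing

/-- A position of the brushing process: the vertices that are still dirty, and the number of
brushes lying on each vertex. An edge is dirty exactly when both of its endpoints are dirty. -/
structure State (V : Type*) where
  dirty : Finset V
  brushes : V → ℕ

/-- The player whose turn it is. -/
inductive Player
  | min
  | max

section

variable {V : Type*} [DecidableEq V] (G : SimpleGraph V)

open Classical in
/-- The dirty neighbours of `v`. -/
noncomputable def dirtyNbrs (s : State V) (v : V) : Finset V :=
  {w ∈ s.dirty | G.Adj v w}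

/-- A dirty vertex is ready to fire when it holds at least as many brushes as it has dirty
neighbours. -/
def Ready (s : State V) (v : V) : Prop :=
  v ∈ s.dirty ∧ (dirtyNbrs G s v).card ≤ s.brushes v

/-- Firing `v`: it sends one brush to each dirty neighbour and becomes clean; excess brushes stay
on `v`. -/
noncomputable def fire (s : State V) (v : V) : State V where
  dirty := s.dirty.erase v
  brushes w :=
    if w = v then s.brushes v - (dirtyNbrs G s v).card
    else if w ∈ dirtyNbrs G s v then s.brushes w + 1
    else s.brushes w

open Classical in
/-- Fire ready vertices one at a time until no vertex is ready. The order is irrelevant, see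
`stabilize_unique`. -/
noncomputable def stabilize (s : State V) : State V :=
  if h : ∃ v, Ready G s v then stabilize (fire G s h.choose) else s
termination_by s.dirty.card
decreasing_by exact Finset.card_erase_lt_of_mem h.choose_spec.1

/-- Add one brush to `v`, without firing anything yet. -/
def addBrush (s : State V) (v : V) : State V where
  dirty := s.dirty
  brushes := Function.update s.brushes v (s.brushes v + 1)

/-- One turn: a brush is added to `v`, then vertices fire until the configuration is stable. -/
noncomputable def turn (s : State V) (v : V) : State V :=
  stabilize G (addBrush s v)

/-- `t` arises from `s` by firing some list of vertices, each of them ready when it fires. -/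
def Reaches (s t : State V) : Prop :=
  Relation.ReflTransGen (fun a b => ∃ v, Ready G a v ∧ b = fire G a v) s t

theorem reaches_stabilize (s : State V) :
    Reaches G s (stabilize G s) ∧ ∀ v, ¬ Ready G (stabilize G s) v := by
  induction hn : s.dirty.card using Nat.strong_induction_on generalizing s with
  | _ n ih =>
    rw [stabilize]
    split_ifs with h
    · have hlt : (fire G s h.choose).dirty.card < n :=
        hn ▸ Finset.card_erase_lt_of_mem h.choose_spec.1
      obtain ⟨h1, h2⟩ := ih _ hlt _ rfl
      exact ⟨Relation.ReflTransGen.head ⟨_, h.choose_spec, rfl⟩ h1, h2⟩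
    · exact ⟨Relation.ReflTransGen.refl, fun v hv => h ⟨v, hv⟩⟩

theorem reaches_invariant {s t : State V} (h : Reaches G s t) :
    t.dirty ⊆ s.dirty ∧ ∀ v ∈ t.dirty,
      t.brushes v + (dirtyNbrs G t v).card = s.brushes v + (dirtyNbrs G s v).card := by
  classical
  induction h with
  | refl => exact ⟨subset_rfl, fun _ _ => rfl⟩
  | @tail b c _ hbc ih =>
    obtain ⟨v, hv, rfl⟩ := hbc
    refine ⟨(Finset.erase_subset _ _).trans ih.1, fun w hw => ?_⟩
    have hw' : w ≠ v ∧ w ∈ b.dirty := by simpa [fire] using hw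
    rw [← ih.2 w hw'.2]
    have he : dirtyNbrs G (fire G b v) w = (dirtyNbrs G b w).erase v := by
      ext x; simp [dirtyNbrs, fire, and_assoc]
    rw [he]
    by_cases ha : G.Adj v w
    · have h1 : v ∈ dirtyNbrs G b w := by simp [dirtyNbrs, hv.1, ha.symm]
      have h2 : w ∈ dirtyNbrs G b v := by simp [dirtyNbrs, hw'.2, ha]
      have h3 := Finset.card_erase_add_one h1
      simp only [fire, hw'.1, h2, if_true, if_false]
      omega
    · have h1 : v ∉ dirtyNbrs G b w := by simp [dirtyNbrs, G.adj_comm w v, ha]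
      have h2 : w ∉ dirtyNbrs G b v := by simp [dirtyNbrs, ha]
      simp [fire, hw'.1, h2, Finset.erase_eq_of_notMem h1]

theorem le_brushes_of_reaches {s t : State V} (h : Reaches G s t) :
    ∀ v ∈ t.dirty, s.brushes v ≤ t.brushes v := by
  classical
  intro v hv
  have h1 := reaches_invariant G h
  have h2 : (dirtyNbrs G t v).card ≤ (dirtyNbrs G s v).card :=
    Finset.card_le_card (Finset.filter_subset_filter _ h1.1)
  have := h1.2 v hv
  omega

theorem subset_of_stable {s t u : State V} (ht : Reaches G s t) (hu : Reaches G s u)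
    (hs : ∀ v, ¬ Ready G u v) : u.dirty ⊆ t.dirty := by
  classical
  induction ht with
  | refl => exact (reaches_invariant G hu).1
  | @tail b c hb hbc ih =>
    obtain ⟨v, hv, rfl⟩ := hbc
    refine fun w hw => Finset.mem_erase.2 ⟨?_, ih hw⟩
    rintro rfl
    have hle : (dirtyNbrs G u w).card ≤ (dirtyNbrs G b w).card :=
      Finset.card_le_card (Finset.filter_subset_filter _ ih)
    have h1 := (reaches_invariant G hu).2 w hw
    have h2 := (reaches_invariant G hb).2 w (ih hw)
    have h3 := hv.2
    exact hs w ⟨hw, by omega⟩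

/-- Every maximal list of firings leaves the same dirty vertices, with the same brushes on them,
so that the choices made in `stabilize` do not matter. -/
theorem stabilize_unique {s t : State V} (h : Reaches G s t) (hs : ∀ v, ¬ Ready G t v) :
    t.dirty = (stabilize G s).dirty ∧
      ∀ v ∈ t.dirty, t.brushes v = (stabilize G s).brushes v := by
  obtain ⟨h1, h2⟩ := reaches_stabilize G s
  have hd : t.dirty = (stabilize G s).dirty :=
    (subset_of_stable G h1 h hs).antisymm (subset_of_stable G h h1 h2)
  refine ⟨hd, fun v hv => ?_⟩
  have e1 := (reaches_invariant G h).2 v hv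
  have e2 := (reaches_invariant G h1).2 v (hd ▸ hv)
  have e3 : dirtyNbrs G t v = dirtyNbrs G (stabilize G s) v := by
    simp only [dirtyNbrs, hd]
  rw [e3] at e1
  omega

end

/-- A bound for the number of turns that can still be played. -/
noncomputable def potential {V : Type*} [Fintype V] (s : State V) : ℕ :=
  ∑ v ∈ s.dirty, (Fintype.card V + 1 - s.brushes v)

theorem turn_decreases {V : Type*} [Fintype V] [DecidableEq V] (G : SimpleGraph V)
    (s : State V) (v : V) (hv : v ∈ s.dirty) :
    potential (turn G s v) + (turn G s v).dirty.card < potential s + s.dirty.card := by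
  obtain ⟨h1, h2⟩ := reaches_stabilize G (addBrush s v)
  have hsub : (turn G s v).dirty ⊆ s.dirty := (reaches_invariant G h1).1
  have hb : ∀ w ∈ (turn G s v).dirty, (addBrush s v).brushes w ≤ (turn G s v).brushes w :=
    le_brushes_of_reaches G h1
  have hs : ∀ w ∈ (turn G s v).dirty, s.brushes w ≤ (turn G s v).brushes w := by
    intro w hw
    refine le_trans ?_ (hb w hw)
    by_cases e : w = v
    · subst e; simp [addBrush]
    · simp [addBrush, e]
  have hP1 : potential (turn G s v) ≤
      ∑ w ∈ (turn G s v).dirty, (Fintype.card V + 1 - s.brushes w) :=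
    Finset.sum_le_sum fun w hw => by have := hs w hw; omega
  have hP2 : ∑ w ∈ (turn G s v).dirty, (Fintype.card V + 1 - s.brushes w) ≤ potential s :=
    Finset.sum_le_sum_of_subset hsub
  by_cases hvt : v ∈ (turn G s v).dirty
  · have hlt : potential (turn G s v) <
        ∑ w ∈ (turn G s v).dirty, (Fintype.card V + 1 - s.brushes w) := by
      refine Finset.sum_lt_sum (fun w hw => by have := hs w hw; omega) ⟨v, hvt, ?_⟩
      have e1 : s.brushes v + 1 ≤ (turn G s v).brushes v := by
        simpa [addBrush] using hb v hvt
      have e2 : (turn G s v).brushes v < (dirtyNbrs G (turn G s v) v).card :=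
        not_le.1 fun hle => h2 v ⟨hvt, hle⟩
      have e3 : (dirtyNbrs G (turn G s v) v).card ≤ Fintype.card V := Finset.card_le_univ _
      omega
    have := Finset.card_le_card hsub
    omega
  · have : (turn G s v).dirty.card < s.dirty.card :=
      Finset.card_lt_card ⟨hsub, fun h => hvt (h hv)⟩
    omega

/-- The number of further turns from position `s` under optimal play, the given player moving
next. A brush may only be placed on a dirty vertex and the game is over once every vertex is
clean; Min minimizes and Max maximizes the number of turns. -/
noncomputable def gameLength {V : Type*} [Fintype V] [DecidableEq V] (G : SimpleGraph V)
    (P : Player) (s : State V) : ℕ :=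
  if h : s.dirty.Nonempty then
    match P with
    | .min => 1 + s.dirty.attach.inf' (Finset.attach_nonempty_iff.2 h)
        fun v => gameLength G .max (turn G s v.1)
    | .max => 1 + s.dirty.attach.sup' (Finset.attach_nonempty_iff.2 h)
        fun v => gameLength G .min (turn G s v.1)
  else 0
termination_by potential s + s.dirty.card
decreasing_by
  all_goals exact turn_decreases G s v.1 v.2

/-- The starting position: every vertex is dirty and there are no brushes; vertices that are
ready at once (the isolated ones) fire. -/
noncomputable def initial {V : Type*} [Fintype V] [DecidableEq V] (G : SimpleGraph V) : State V :=
  stabilize G ⟨Finset.univ, fun _ => 0⟩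

/-- The game brush number: the length of the Min-start game under optimal play. -/
noncomputable def gameBrushNumber {V : Type*} [Fintype V] [DecidableEq V] (G : SimpleGraph V) : ℕ :=
  gameLength G .min (initial G)

end Brushing

set_option linter.unusedSectionVars false

/-! The load of a vertex is its number of brushes plus its number of dirty neighbours. It does not
change when other vertices fire, it grows by one with each brush, and a dirty vertex is ready
exactly when its load is at least twice its number of dirty neighbours. So loads start at the
degrees, and the number of turns is the sum over vertices of (degree plus brushes received) minus
the sum of the degrees. If all cuts have about the expected size (`CutBound`), then in total the
numbers of neighbours in a set of `k` dirty vertices differ little from `p k`. The game becomes one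
on loads with firing threshold about `2 p k`.

Upper bound. Min repeatedly takes the `m` dirty vertices of largest load and plays on them alone
until they are clean. Every second move is his, so a phase lasts about twice as many turns as these
vertices receive brushes. Put `E = p k ^ 2` and let `B` be the total load, cut off at the threshold.
In the limit, cleaning vertices of average load makes `pot E B = E - B + E exp (B / E - 2)` fall by
exactly the number of turns. Convexity (`pot_tangent`) makes this a bound for phases of positive
length. The potential is nonnegative and starts near `E = B = p n ^ 2`, where it equals `p n ^ 2 /
e`.

Lower bound. Max always plays on a dirty vertex of least load. While the least load rises from `ℓ`
to `ℓ + 1`, Max moves at most once per vertex of load at most `ℓ`, and Min at most once more. This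
bounds the height `MaxPlay.S` of the loads above `ℓ`, where the `i`-th largest load counts only up
to its firing value `2 p (n - i)`. The limiting recursion has the solution `ℓ = λ p n`, `S = p n ^ 2
(1 - κ) (1 + κ - λ)` with `λ = κ (1 - 2 log κ)`. Having `x = n - ℓ / (2 p)` clean vertices at level
`ℓ` needs height about `p x ^ 2`, which exceeds the available height by `p n ^ 2 (κ - λ / 2) ^ 2`.
This is positive as long as `κ > exp (-1/2)`, so about `n - x` vertices are still dirty and end with
load at least `ℓ`. Adding the firing values of the first `x` vertices gives about `ℓ ^ 2 / (4 p)`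
turns, which tends to `p n ^ 2 / e` as `κ` decreases to `exp (-1/2)`.

A Chernoff bound and a union over the `4 ^ n` pairs of vertex sets give the cut bound for the random
graph. Of the density assumption this uses `p n → ∞`. -/

namespace Brushing

/-! ### Loads, and the order of firing inside one round -/

section Load

variable {V : Type*} [DecidableEq V] (G : SimpleGraph V)

/-- Brushes plus dirty neighbours; invariant under firing of other vertices. -/
noncomputable def load (s : State V) (v : V) : ℕ :=
  s.brushes v + (dirtyNbrs G s v).card

/-- No dirty vertex is ready to fire. -/
def Stable (s : State V) : Prop := ∀ v, ¬ Ready G s v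

theorem stable_turn (s : State V) (v : V) : Stable G (turn G s v) :=
  (reaches_stabilize G _).2

theorem stable_initial [Fintype V] : Stable G (initial G) :=
  (reaches_stabilize G _).2

theorem Stable.load_lt {s : State V} (hs : Stable G s) {v : V} (hv : v ∈ s.dirty) :
    load G s v < 2 * (dirtyNbrs G s v).card := by
  have : ¬ (dirtyNbrs G s v).card ≤ s.brushes v := fun h => hs v ⟨hv, h⟩
  unfold load
  omega

theorem dirtyNbrs_mono {s t : State V} (h : t.dirty ⊆ s.dirty) (v : V) :
    dirtyNbrs G t v ⊆ dirtyNbrs G s v := by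
  classical
  exact Finset.filter_subset_filter _ h

theorem turn_dirty_subset (s : State V) (v : V) : (turn G s v).dirty ⊆ s.dirty :=
  (reaches_invariant G (reaches_stabilize G (addBrush s v)).1).1

theorem load_addBrush (s : State V) (v w : V) :
    load G (addBrush s v) w = load G s w + if w = v then 1 else 0 := by
  have : dirtyNbrs G (addBrush s v) w = dirtyNbrs G s w := rfl
  unfold load
  rw [this]
  by_cases h : w = v
  · subst h; simp [addBrush]; omega
  · simp [addBrush, h]

theorem load_stabilize (s : State V) {w : V} (hw : w ∈ (stabilize G s).dirty) :
    load G (stabilize G s) w = load G s w :=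
  (reaches_invariant G (reaches_stabilize G s).1).2 w hw

theorem load_turn (s : State V) (v : V) {w : V} (hw : w ∈ (turn G s v).dirty) :
    load G (turn G s v) w = load G s w + if w = v then 1 else 0 := by
  rw [← load_addBrush]
  exact load_stabilize G _ hw

/-- The vertices fired between `s` and `t` can be ranked so that each one has enough load for the
neighbours that are dirty when it fires. -/
theorem exists_rank_of_reaches {s t : State V} (h : Reaches G s t) :
    ∃ r : V → ℕ, (∀ v ∈ s.dirty \ t.dirty, r v + t.dirty.card < s.dirty.card) ∧
      Set.InjOn r ↑(s.dirty \ t.dirty) ∧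
      ∀ v ∈ s.dirty \ t.dirty, ∀ A : Finset V, A ⊆ s.dirty →
        (∀ u ∈ A, G.Adj v u ∧ (u ∈ t.dirty ∨ r v < r u)) → 2 * A.card ≤ load G s v := by
  classical
  induction h with
  | refl => exact ⟨fun _ => 0, by simp, by simp, by simp⟩
  | @tail b c hb hbc ih =>
    obtain ⟨v, hv, rfl⟩ := hbc
    obtain ⟨r, h1, h2, h3⟩ := ih
    obtain ⟨hsub, hinv⟩ := reaches_invariant G hb
    have hc : (fire G b v).dirty = b.dirty.erase v := rfl
    have hcard := Finset.card_erase_add_one hv.1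
    have hle := Finset.card_le_card hsub
    set N := s.dirty.card - b.dirty.card with hN
    have hrlt : ∀ x ∈ s.dirty \ b.dirty, r x < N := fun x hx => by
      have := h1 x hx; omega
    have hmem : ∀ x, x ∈ s.dirty \ (b.dirty.erase v) ↔ x = v ∨ x ∈ s.dirty \ b.dirty := by
      intro x
      simp only [Finset.mem_sdiff, Finset.mem_erase]
      have := hsub hv.1
      by_cases hx : x = v
      · subst hx; simp [this]
      · simp [hx]
    have hne : ∀ x ∈ s.dirty \ b.dirty, x ≠ v := by
      rintro x hx rfl
      exact (Finset.mem_sdiff.1 hx).2 hv.1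
    -- `N` is the number of vertices fired before `v`, so the new rank exceeds all earlier ones.
    refine ⟨Function.update r v N, ?_, ?_, ?_⟩
    · intro x hx
      rw [hc] at hx ⊢
      rcases (hmem x).1 hx with rfl | hx
      · simp; omega
      · rw [Function.update_of_ne (hne x hx)]
        have := hrlt x hx; omega
    · intro x hx y hy hxy
      rw [hc] at hx hy
      rcases (hmem x).1 (Finset.mem_coe.1 hx) with rfl | hx' <;>
        rcases (hmem y).1 (Finset.mem_coe.1 hy) with rfl | hy'
      · rfl
      · rw [Function.update_self, Function.update_of_ne (hne y hy')] at hxy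
        have := hrlt y hy'; omega
      · rw [Function.update_self, Function.update_of_ne (hne x hx')] at hxy
        have := hrlt x hx'; omega
      · rw [Function.update_of_ne (hne x hx'), Function.update_of_ne (hne y hy')] at hxy
        exact h2 (by simpa using hx') (by simpa using hy') hxy
    · intro x hx A hA hAx
      rw [hc] at hx
      rcases (hmem x).1 hx with rfl | hx'
      -- Vertices fired before `x` have rank below `N`, so all of `A` is still dirty when `x` fires.
      -- Then `x` has at least `A.card` brushes and at least `A.card` dirty neighbours.
      · have : A ⊆ dirtyNbrs G b x := by
          intro u hu
          obtain ⟨ha, hor⟩ := hAx u hu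
          have hub : u ∈ b.dirty := by
            rcases hor with h | h
            · exact (Finset.mem_erase.1 h).2
            · by_contra hub
              have hu' : u ∈ s.dirty \ b.dirty := Finset.mem_sdiff.2 ⟨hA hu, hub⟩
              rw [Function.update_self, Function.update_of_ne (hne u hu')] at h
              have := hrlt u hu'; omega
          simp [dirtyNbrs, hub, ha]
        have h5 := Finset.card_le_card this
        have h6 := hinv x hv.1
        have h7 := hv.2
        unfold load
        omega
      · refine h3 x hx' A hA fun u hu => ⟨(hAx u hu).1, ?_⟩
        by_cases hub : u ∈ b.dirty
        · exact Or.inl hub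
        · refine Or.inr ?_
          have hu' : u ∈ s.dirty \ b.dirty := Finset.mem_sdiff.2 ⟨hA hu, hub⟩
          rcases (hAx u hu).2 with h | h
          · exact absurd (Finset.mem_erase.1 h).2 hub
          · rwa [Function.update_of_ne (hne u hu'), Function.update_of_ne (hne x hx')] at h

end Load

/-! ### Strategies: from the game tree to single plays -/

section Strategies

variable {V : Type*} [Fintype V] [DecidableEq V] (G : SimpleGraph V)

theorem gameLength_of_dirty_eq_empty {P : Player} {s : State V} (h : s.dirty = ∅) :
    gameLength G P s = 0 := by
  rw [gameLength, dif_neg (by simp [h])]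

theorem gameLength_min_le {s : State V} {v : V} (hv : v ∈ s.dirty) :
    gameLength G .min s ≤ 1 + gameLength G .max (turn G s v) := by
  rw [gameLength, dif_pos ⟨v, hv⟩]
  exact Nat.add_le_add_left (Finset.inf'_le _ (Finset.mem_attach _ ⟨v, hv⟩)) 1

theorem le_gameLength_max {s : State V} {v : V} (hv : v ∈ s.dirty) :
    1 + gameLength G .min (turn G s v) ≤ gameLength G .max s := by
  conv_rhs => rw [gameLength, dif_pos ⟨v, hv⟩]
  exact Nat.add_le_add_left (Finset.le_sup'
    (fun v : s.dirty => gameLength G .min (turn G s v.1)) (Finset.mem_attach _ ⟨v, hv⟩)) 1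

theorem exists_gameLength_min_eq {s : State V} (h : s.dirty.Nonempty) :
    ∃ v ∈ s.dirty, gameLength G .min s = 1 + gameLength G .max (turn G s v) := by
  obtain ⟨v, -, hv⟩ := Finset.exists_mem_eq_inf' (Finset.attach_nonempty_iff.2 h)
    fun v : s.dirty => gameLength G .max (turn G s v.1)
  refine ⟨v.1, v.2, ?_⟩
  conv_lhs => rw [gameLength, dif_pos h]
  simp only [hv]

theorem exists_gameLength_max_eq {s : State V} (h : s.dirty.Nonempty) :
    ∃ v ∈ s.dirty, gameLength G .max s = 1 + gameLength G .min (turn G s v) := by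
  obtain ⟨v, -, hv⟩ := Finset.exists_mem_eq_sup' (Finset.attach_nonempty_iff.2 h)
    fun v : s.dirty => gameLength G .min (turn G s v.1)
  refine ⟨v.1, v.2, ?_⟩
  conv_lhs => rw [gameLength, dif_pos h]
  simp only [hv]

/-- If Min puts brushes only on a set `S` until it is clean, then some play of this kind, in which
`v` receives `cnt v` brushes, is at least as long as the game. -/
theorem exists_play_cleaning (S : Finset V) (P : Player) (s : State V) (hs : Stable G s) :
    ∃ (s' : State V) (P' : Player) (cnt : V → ℕ),
      Stable G s' ∧ s'.dirty ⊆ s.dirty ∧ Disjoint S s'.dirty ∧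
      (∀ v, 0 < cnt v → v ∈ s.dirty ∧ load G s v + cnt v ≤ 2 * (dirtyNbrs G s v).card) ∧
      (∀ v ∈ s'.dirty, load G s' v = load G s v + cnt v) ∧
      ∑ v, cnt v ≤ 2 * ∑ v ∈ S, cnt v + (match P with | .min => 0 | .max => 1) ∧
      gameLength G P s ≤ ∑ v, cnt v + gameLength G P' s' := by
  induction hn : potential s + s.dirty.card using Nat.strong_induction_on generalizing s P with
  | _ n ih =>
    by_cases hd : Disjoint S s.dirty
    · exact ⟨s, P, fun _ => 0, hs, subset_rfl, hd, by simp, by simp, by simp, by simp⟩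
    -- One turn is put in front of the play given by induction. The condition on `a` and `b` is the
    -- count of turns: every move of Min lies in `S`, and Max has at most one move more than Min,
    -- only if he starts.
    have key : ∀ (Q : Player) (x : V), x ∈ s.dirty →
        gameLength G P s ≤ 1 + gameLength G Q (turn G s x) →
        (∀ a b : ℕ, a ≤ 2 * b + (match Q with | .min => 0 | .max => 1) →
          a + 1 ≤ 2 * (b + if x ∈ S then 1 else 0) + (match P with | .min => 0 | .max => 1)) →
        ∃ (s' : State V) (P' : Player) (cnt : V → ℕ),
      Stable G s' ∧ s'.dirty ⊆ s.dirty ∧ Disjoint S s'.dirty ∧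
      (∀ v, 0 < cnt v → v ∈ s.dirty ∧ load G s v + cnt v ≤ 2 * (dirtyNbrs G s v).card) ∧
      (∀ v ∈ s'.dirty, load G s' v = load G s v + cnt v) ∧
      ∑ v, cnt v ≤ 2 * ∑ v ∈ S, cnt v + (match P with | .min => 0 | .max => 1) ∧
      gameLength G P s ≤ ∑ v, cnt v + gameLength G P' s' := by
      intro Q x hx hg hab
      obtain ⟨s', P', cnt, h1, h2, h3, h4, h5, h6, h7⟩ :=
        ih _ (hn ▸ turn_decreases G s x hx) Q (turn G s x) (stable_turn G s x) rfl
      have hsum : ∑ v, (cnt v + if v = x then 1 else 0) = ∑ v, cnt v + 1 := by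
        simp [Finset.sum_add_distrib]
      refine ⟨s', P', fun v => cnt v + if v = x then 1 else 0, h1,
        h2.trans (turn_dirty_subset G s x), h3, ?_, ?_, ?_, ?_⟩
      · intro v hv
        by_cases hc : 0 < cnt v
        · obtain ⟨h8, h9⟩ := h4 v hc
          rw [load_turn G s x h8] at h9
          have := Finset.card_le_card (dirtyNbrs_mono G (turn_dirty_subset G s x) v)
          exact ⟨turn_dirty_subset G s x h8, by simp only []; omega⟩
        · have hvx : v = x := by
            by_contra hvx
            simp [hvx] at hv
            omega
          subst hvx
          -- In a stable position the load is strictly below twice the dirty degree, so one more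
          -- brush cannot exceed it.
          have := hs.load_lt G hx
          refine ⟨hx, ?_⟩
          simp
          omega
      · intro v hv
        rw [h5 v hv, load_turn G s x (h2 hv)]
        simp only []
        omega
      · rw [hsum, Finset.sum_add_distrib, Finset.sum_ite_eq' S x (fun _ => 1)]
        exact hab _ _ h6
      · rw [hsum]
        omega
    rw [Finset.not_disjoint_iff] at hd
    obtain ⟨x, hxS, hxd⟩ := hd
    cases P with
    | min =>
      exact key .max x hxd (gameLength_min_le G hxd) (by intro a b h; simp [hxS] at h ⊢; omega)
    | max =>
      obtain ⟨y, hy, he⟩ := exists_gameLength_max_eq G ⟨x, hxd⟩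
      exact key .min y hy he.le (by intro a b h; simp at h ⊢; omega)

/-- Against a positional strategy `f` of Max, some play is at most as long as the game. -/
theorem exists_play_of_max_strategy (f : State V → V)
    (hf : ∀ s : State V, s.dirty.Nonempty → f s ∈ s.dirty) (P : Player) (s : State V) :
    ∃ (T : ℕ) (st : ℕ → State V) (mv : ℕ → V), st 0 = s ∧
      (∀ i < T, mv i ∈ (st i).dirty ∧ st (i + 1) = turn G (st i) (mv i)) ∧
      (st T).dirty = ∅ ∧ T ≤ gameLength G P s ∧
      ∀ i < T, (P = .min ∧ Odd i ∨ P = .max ∧ Even i) → mv i = f (st i) := by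
  induction hn : potential s + s.dirty.card using Nat.strong_induction_on generalizing s P with
  | _ n ih =>
    rcases s.dirty.eq_empty_or_nonempty with he | hne
    · exact ⟨0, fun _ => s, fun _ => f s, rfl, by simp, he, by simp, by simp⟩
    have key : ∀ (Q : Player) (x : V), x ∈ s.dirty →
        1 + gameLength G Q (turn G s x) ≤ gameLength G P s →
        (∀ i, (P = .min ∧ Odd (i + 1) ∨ P = .max ∧ Even (i + 1)) →
          (Q = .min ∧ Odd i ∨ Q = .max ∧ Even i)) →
        ((P = .min ∧ Odd 0 ∨ P = .max ∧ Even 0) → x = f s) →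
        ∃ (T : ℕ) (st : ℕ → State V) (mv : ℕ → V), st 0 = s ∧
      (∀ i < T, mv i ∈ (st i).dirty ∧ st (i + 1) = turn G (st i) (mv i)) ∧
      (st T).dirty = ∅ ∧ T ≤ gameLength G P s ∧
      ∀ i < T, (P = .min ∧ Odd i ∨ P = .max ∧ Even i) → mv i = f (st i) := by
      intro Q x hx hg hQ hx0
      obtain ⟨T, st, mv, h0, h1, h2, h3, h4⟩ :=
        ih _ (hn ▸ turn_decreases G s x hx) Q (turn G s x) rfl
      refine ⟨T + 1, fun i => Nat.casesOn i s st, fun i => Nat.casesOn i x mv, rfl, ?_, h2,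
        by omega, ?_⟩
      · rintro (_ | i) hi
        · exact ⟨hx, h0⟩
        · exact h1 i (by omega)
      · rintro (_ | i) hi hp
        · exact hx0 hp
        · exact h4 i (by omega) (hQ i hp)
    cases P with
    | min =>
      obtain ⟨y, hy, he⟩ := exists_gameLength_min_eq G hne
      exact key .max y hy he.ge (by intro i; simp; grind) (by simp)
    | max =>
      exact key .min (f s) (hf s hne) (le_gameLength_max G (hf s hne))
        (by intro i; simp; grind) (fun _ => rfl)

/-- The number of neighbours of `v` in `T`. -/
noncomputable def nbrs (T : Finset V) (v : V) : ℕ := by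
  classical exact (T.filter (G.Adj v)).card

/-- A play of the game in which Max always puts his brush on a dirty vertex of least load. -/
structure MaxPlay where
  /-- the number of turns -/
  T : ℕ
  /-- the vertices receiving brushes -/
  mv : ℕ → V
  /-- the dirty vertices after a number of turns -/
  dirty : ℕ → Finset V
  /-- the order of firing -/
  rank : V → ℕ
  rank_inj : Function.Injective rank
  dirty_anti : ∀ i < T, dirty (i + 1) ⊆ dirty i
  dirty_T : dirty T = ∅
  mv_mem : ∀ i < T, mv i ∈ dirty i
  mv_min : ∀ i < T, Odd i → ∀ u ∈ dirty i,
    nbrs G Finset.univ (mv i) + ((Finset.range i).filter (mv · = mv i)).card ≤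
      nbrs G Finset.univ u + ((Finset.range i).filter (mv · = u)).card
  fire_le : ∀ (v : V) (A : Finset V), (∀ u ∈ A, G.Adj v u ∧ rank v < rank u) →
    2 * A.card ≤ nbrs G Finset.univ v + ((Finset.range T).filter (mv · = v)).card
  rank_lt : ∀ i ≤ T, ∀ v ∉ dirty i, ∀ u ∈ dirty i, rank v < rank u

/-- The least-load strategy may be suboptimal for Max, so an optimal reply of Min produces a play no
longer than the game. The lower bound needs nothing else about the game tree. -/
theorem exists_maxPlay [Nonempty V] : ∃ p : MaxPlay G, p.T ≤ gameBrushNumber G := by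
  classical
  have hex : ∀ s : State V, ∃ v, s.dirty.Nonempty → v ∈ s.dirty ∧
      ∀ u ∈ s.dirty, load G s v ≤ load G s u := by
    intro s
    by_cases hs : s.dirty.Nonempty
    · obtain ⟨v, hv, hmin⟩ := Finset.exists_min_image s.dirty (load G s) hs
      exact ⟨v, fun _ => ⟨hv, hmin⟩⟩
    · exact ⟨Classical.arbitrary V, fun h => absurd h hs⟩
  choose f hf using hex
  obtain ⟨T, st, mv, h0, hstep, hT, hTle, hmax⟩ :=
    exists_play_of_max_strategy G f (fun s hs => (hf s hs).1) .min (initial G)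
  -- the position in which the `i`-th round of firing starts
  let pre : ℕ → State V := fun i =>
    Nat.casesOn i ⟨Finset.univ, fun _ => 0⟩ fun i => addBrush (st i) (mv i)
  have hst : ∀ i ≤ T, st i = stabilize G (pre i) := by
    rintro (_ | i) hi
    · exact h0
    · exact (hstep i (by omega)).2
  have hanti1 : ∀ i < T, (st (i + 1)).dirty ⊆ (st i).dirty := fun i hi => by
    rw [(hstep i hi).2]; exact turn_dirty_subset G _ _
  have hanti : ∀ i j, i ≤ j → j ≤ T → (st j).dirty ⊆ (st i).dirty := by
    intro i j hij
    induction j, hij using Nat.le_induction with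
    | base => exact fun _ => subset_rfl
    | succ j hij ih => exact fun hj => (hanti1 j (by omega)).trans (ih (by omega))
  have hpresub : ∀ i ≤ T, (st i).dirty ⊆ (pre i).dirty := fun i hi => by
    rw [hst i hi]; exact (reaches_invariant G (reaches_stabilize G (pre i)).1).1
  have hload : ∀ i ≤ T, ∀ v ∈ (pre i).dirty, load G (pre i) v =
      nbrs G Finset.univ v + ((Finset.range i).filter (mv · = v)).card := by
    intro i
    induction i with
    | zero => intro _ v _; simp [load, pre, nbrs, dirtyNbrs]
    | succ i ih =>
      intro hi v hv
      have hv' : v ∈ (st i).dirty := hv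
      have e1 : load G (st i) v = load G (pre i) v := by
        have h := hst i (by omega)
        rw [h] at hv' ⊢
        exact load_stabilize G _ hv'
      have e2 : load G (pre (i + 1)) v = load G (st i) v + if v = mv i then 1 else 0 :=
        load_addBrush G (st i) (mv i) v
      rw [e2, e1, ih (by omega) v (hpresub i (by omega) hv'), Finset.range_add_one,
        Finset.filter_insert]
      by_cases h : mv i = v
      · simp [h]; omega
      · simp [h, Ne.symm h]
  have hload' : ∀ i ≤ T, ∀ v ∈ (st i).dirty, load G (st i) v =
      nbrs G Finset.univ v + ((Finset.range i).filter (mv · = v)).card := by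
    intro i hi v hv
    rw [← hload i hi v (hpresub i hi hv)]
    have h := hst i hi
    rw [h] at hv ⊢
    exact load_stabilize G _ hv
  have hr : ∀ i, ∃ r : V → ℕ, i ≤ T →
      (∀ v ∈ (pre i).dirty \ (st i).dirty, r v < Fintype.card V) ∧
      Set.InjOn r ↑((pre i).dirty \ (st i).dirty) ∧
      ∀ v ∈ (pre i).dirty \ (st i).dirty, ∀ A : Finset V, A ⊆ (pre i).dirty →
        (∀ u ∈ A, G.Adj v u ∧ (u ∈ (st i).dirty ∨ r v < r u)) →
          2 * A.card ≤ load G (pre i) v := by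
    intro i
    by_cases hi : i ≤ T
    · obtain ⟨r, h1, h2, h3⟩ := exists_rank_of_reaches G (reaches_stabilize G (pre i)).1
      rw [← hst i hi] at h1 h2 h3
      refine ⟨r, fun _ => ⟨fun v hv => ?_, h2, h3⟩⟩
      have := h1 v hv
      have := Finset.card_le_univ (pre i).dirty
      omega
    · exact ⟨fun _ => 0, fun h => absurd h hi⟩
  choose r hr using hr
  have hclean : ∀ v : V, ∃ i, v ∉ (st i).dirty := fun v => ⟨T, by simp [hT]⟩
  let b : V → ℕ := fun v => Nat.find (hclean v)
  have hbT : ∀ v, b v ≤ T := fun v => Nat.find_min' (hclean v) (by simp [hT])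
  have hbv : ∀ v, v ∉ (st (b v)).dirty := fun v => Nat.find_spec (hclean v)
  have hblt : ∀ v i, i < b v → v ∈ (st i).dirty := fun v i hi => by
    simpa using Nat.find_min (hclean v) hi
  have hbpre : ∀ v i, i ≤ b v → v ∈ (pre i).dirty := by
    rintro v (_ | i) hi
    · exact Finset.mem_univ _
    · exact hblt v i (by omega)
  have hb_le : ∀ v i, i ≤ T → v ∉ (st i).dirty → b v ≤ i := fun v i _ hv =>
    Nat.find_min' (hclean v) hv
  have hb_gt : ∀ v i, i ≤ T → v ∈ (st i).dirty → i < b v := fun v i hi hv => by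
    by_contra hle
    exact hbv v (hanti (b v) i (by omega) hi hv)
  have hbd : ∀ v, v ∈ (pre (b v)).dirty \ (st (b v)).dirty := fun v =>
    Finset.mem_sdiff.2 ⟨hbpre v _ le_rfl, hbv v⟩
  have hrlt : ∀ v, r (b v) v < Fintype.card V := fun v => (hr (b v) (hbT v)).1 v (hbd v)
  have hlex : ∀ u v, b v * Fintype.card V + r (b v) v < b u * Fintype.card V + r (b u) u →
      b v < b u ∨ b v = b u ∧ r (b v) v < r (b u) u := by
    intro u v h
    rcases lt_trichotomy (b v) (b u) with h1 | h1 | h1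
    · exact Or.inl h1
    · refine Or.inr ⟨h1, ?_⟩
      rw [h1] at h ⊢
      omega
    · have := hrlt u
      have h2 := Nat.mul_le_mul_right (Fintype.card V) (Nat.succ_le_of_lt h1)
      rw [Nat.succ_mul] at h2
      omega
  have hlex' : ∀ u v, b v < b u →
      b v * Fintype.card V + r (b v) v < b u * Fintype.card V + r (b u) u := by
    intro u v h1
    have := hrlt v
    have h2 := Nat.mul_le_mul_right (Fintype.card V) (Nat.succ_le_of_lt h1)
    rw [Nat.succ_mul] at h2
    omega
  -- The rank is lexicographic: first the round `b v` in which `v` fires, then its place inside that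
  -- round, which is below `Fintype.card V`.
  refine ⟨⟨T, mv, fun i => (st i).dirty, fun v => b v * Fintype.card V + r (b v) v, ?_, hanti1, hT,
    fun i hi => (hstep i hi).1, ?_, ?_, ?_⟩, hTle⟩
  · intro u v h
    simp only [] at h
    have hbe : b u = b v := by
      rcases lt_trichotomy (b u) (b v) with h1 | h1 | h1
      · have := hlex' v u h1; omega
      · exact h1
      · have := hlex' u v h1; omega
    have hu := hbd u
    rw [hbe] at h hu
    exact (hr (b v) (hbT v)).2.1 (Finset.mem_coe.2 hu) (Finset.mem_coe.2 (hbd v)) (by omega)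
  · intro i hi hodd u hu
    have hm := (hf (st i) ⟨u, hu⟩)
    rw [← hmax i hi (Or.inl ⟨rfl, hodd⟩)] at hm
    have := hm.2 u hu
    rwa [hload' i hi.le _ hm.1, hload' i hi.le _ hu] at this
  · intro v A hA
    refine ((hr (b v) (hbT v)).2.2 v (hbd v) A ?_ ?_).trans ?_
    · intro u hu
      rcases hlex u v (hA u hu).2 with h | h
      · exact hbpre u _ h.le
      · exact hbpre u _ h.1.le
    · intro u hu
      refine ⟨(hA u hu).1, ?_⟩
      rcases hlex u v (hA u hu).2 with h | ⟨h, h'⟩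
      · exact Or.inl (hblt u _ h)
      · rw [← h] at h'; exact Or.inr h'
    · rw [hload (b v) (hbT v) v (hbpre v _ le_rfl)]
      have : (Finset.range (b v)).filter (mv · = v) ⊆ (Finset.range T).filter (mv · = v) :=
        Finset.filter_subset_filter _ (Finset.range_subset_range.2 (hbT v))
      have := Finset.card_le_card this
      omega
  · intro i hi v hv u hu
    exact hlex' u v ((hb_le v i hi hv).trans_lt (hb_gt u i hi hu))

end Strategies
end Brushing

namespace Brushing

/-! ### Cut bounds -/

section Cut

variable {V : Type*} [Fintype V] [DecidableEq V] (G : SimpleGraph V)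

/-- The number of pairs in `S × T` joined by an edge differs from `p |S| |T|` by at most `Δ`. -/
def CutBound (p Δ : ℝ) : Prop :=
  ∀ S T : Finset V, |∑ v ∈ S, (nbrs G T v : ℝ) - p * S.card * T.card| ≤ Δ

variable {G}

theorem nbrs_mono {S T : Finset V} (h : S ⊆ T) (v : V) : nbrs G S v ≤ nbrs G T v := by
  classical
  exact Finset.card_le_card (Finset.filter_subset_filter _ h)

theorem nbrs_le_add {R S T : Finset V} (h : R ⊆ S ∪ T) (v : V) :
    nbrs G R v ≤ nbrs G S v + nbrs G T v := by
  classical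
  refine (nbrs_mono h v).trans ?_
  unfold nbrs
  rw [Finset.filter_union]
  exact Finset.card_union_le _ _

theorem CutBound.nonneg {p Δ : ℝ} (h : CutBound G p Δ) : 0 ≤ Δ :=
  (abs_nonneg _).trans (h ∅ ∅)

/-- Splitting `S` by the sign of the deviation leaves two cuts, each with error at most `Δ`. This
turns control of cuts into control of degrees on average. -/
theorem CutBound.sum_abs_le {p Δ : ℝ} (h : CutBound G p Δ) (S T : Finset V) :
    ∑ v ∈ S, |(nbrs G T v : ℝ) - p * T.card| ≤ 2 * Δ := by
  rw [← Finset.sum_filter_add_sum_filter_not S fun v => 0 ≤ (nbrs G T v : ℝ) - p * T.card]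
  have h1 := (abs_le.1 (h (S.filter fun v => 0 ≤ (nbrs G T v : ℝ) - p * T.card) T)).2
  have h2 := (abs_le.1 (h (S.filter fun v => ¬ 0 ≤ (nbrs G T v : ℝ) - p * T.card) T)).1
  have e1 : ∑ v ∈ S.filter (fun v => 0 ≤ (nbrs G T v : ℝ) - p * T.card),
      |(nbrs G T v : ℝ) - p * T.card| =
      ∑ v ∈ S.filter (fun v => 0 ≤ (nbrs G T v : ℝ) - p * T.card),
        ((nbrs G T v : ℝ) - p * T.card) :=
    Finset.sum_congr rfl fun v hv => abs_of_nonneg (Finset.mem_filter.1 hv).2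
  have e2 : ∑ v ∈ S.filter (fun v => ¬ 0 ≤ (nbrs G T v : ℝ) - p * T.card),
      |(nbrs G T v : ℝ) - p * T.card| =
      ∑ v ∈ S.filter (fun v => ¬ 0 ≤ (nbrs G T v : ℝ) - p * T.card),
        -((nbrs G T v : ℝ) - p * T.card) :=
    Finset.sum_congr rfl fun v hv => abs_of_neg (not_le.1 (Finset.mem_filter.1 hv).2)
  rw [e1, e2]
  simp only [Finset.sum_neg_distrib, Finset.sum_sub_distrib, Finset.sum_const, nsmul_eq_mul]
  nlinarith

/-- The only non-adjacent pairs in `S × T` are the diagonal ones, of which there are at most `n`. -/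
theorem cutBound_top [Nonempty V] : CutBound (⊤ : SimpleGraph V) 1 (Fintype.card V) := by
  classical
  intro S T
  have h : ∀ v, (nbrs (⊤ : SimpleGraph V) T v : ℝ) = T.card - if v ∈ T then 1 else 0 := by
    intro v
    have : T.filter ((⊤ : SimpleGraph V).Adj v) = T.erase v := by
      ext u; simp [and_comm, ne_comm]
    unfold nbrs
    rw [Finset.filter_congr_decidable, this]
    by_cases hv : v ∈ T
    · have := Finset.card_erase_add_one hv
      rw [if_pos hv, ← this]; push_cast; ring
    · rw [if_neg hv, Finset.erase_eq_of_notMem hv]; ring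
  simp_rw [h]
  rw [Finset.sum_sub_distrib]
  simp only [Finset.sum_const, nsmul_eq_mul, Finset.sum_boole]
  have h1 : ((S.filter (· ∈ T)).card : ℝ) ≤ Fintype.card V := by
    exact_mod_cast Finset.card_le_univ _
  rw [abs_le]
  constructor <;> nlinarith [Nat.cast_nonneg (α := ℝ) (S.filter (· ∈ T)).card]

end Cut

/-! ### Later neighbours in an arbitrary ordering -/

section Position

variable {V : Type*} [Fintype V] [DecidableEq V] {rank : V → ℕ}

/-- The number of vertices of smaller rank. -/
def pos (rank : V → ℕ) (v : V) : ℕ := (Finset.univ.filter fun u => rank u < rank v).card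

theorem pos_lt_card (v : V) : pos rank v < Fintype.card V := by
  refine Finset.card_lt_univ_of_notMem (x := v) ?_
  simp

theorem pos_lt_pos {u v : V} (h : rank u < rank v) : pos rank u < pos rank v := by
  refine Finset.card_lt_card ⟨fun x hx => ?_, fun hsub => ?_⟩
  · simp only [Finset.mem_filter, Finset.mem_univ, true_and] at hx ⊢
    omega
  · have := hsub (show u ∈ _ by simpa using h)
    simp at this

theorem pos_lt_pos_iff {u v : V} : pos rank u < pos rank v ↔ rank u < rank v := by
  refine ⟨fun h => ?_, pos_lt_pos⟩
  by_contra hle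
  rcases (not_lt.1 hle).lt_or_eq with h1 | h1
  · have := pos_lt_pos h1; omega
  · simp [pos, h1] at h

theorem pos_injective (h : Function.Injective rank) : Function.Injective (pos rank) := by
  intro u v huv
  rcases lt_trichotomy (rank u) (rank v) with h1 | h1 | h1
  · have := pos_lt_pos h1; omega
  · exact h h1
  · have := pos_lt_pos h1; omega

theorem image_pos (h : Function.Injective rank) :
    Finset.univ.image (pos rank) = Finset.range (Fintype.card V) := by
  refine Finset.eq_of_subset_of_card_le ?_ ?_
  · intro i hi
    obtain ⟨v, -, rfl⟩ := Finset.mem_image.1 hi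
    exact Finset.mem_range.2 (pos_lt_card v)
  · rw [Finset.card_image_of_injective _ (pos_injective h), Finset.card_range, Finset.card_univ]

theorem sum_pos {α : Type*} [AddCommMonoid α] (h : Function.Injective rank) (q : ℕ → Prop)
    [DecidablePred q] (f : ℕ → α) :
    ∑ v ∈ Finset.univ.filter (fun v => q (pos rank v)), f (pos rank v) =
      ∑ i ∈ (Finset.range (Fintype.card V)).filter q, f i := by
  rw [← image_pos h, Finset.filter_image, Finset.sum_image]
  exact fun x _ y _ hxy => pos_injective h hxy

theorem card_pos (h : Function.Injective rank) (q : ℕ → Prop) [DecidablePred q] :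
    (Finset.univ.filter (fun v => q (pos rank v))).card =
      ((Finset.range (Fintype.card V)).filter q).card := by
  simp only [Finset.card_eq_sum_ones]
  exact sum_pos h q fun _ => 1

variable {G : SimpleGraph V}

/-- In any ordering of the vertices, most vertices have about the expected number of later
neighbours. -/
theorem CutBound.sum_abs_later_le {p Δ : ℝ} (hG : CutBound G p Δ) (hp : 0 ≤ p)
    (h : Function.Injective rank) {M m : ℕ} (hm : 0 < m) (hMm : Fintype.card V ≤ M * m) :
    ∑ v, |(nbrs G (Finset.univ.filter fun u => rank v < rank u) v : ℝ) -
      p * ((Fintype.card V : ℝ) - pos rank v)| ≤ M * (3 * Δ + 2 * p * m ^ 2) := by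
  classical
  set n := Fintype.card V with hn
  -- The order is cut into `M` blocks of at most `m` consecutive positions. For `v` in a block `B`,
  -- the later vertices agree, up to vertices of `B`, with the set `R` of all vertices from the
  -- start of `B` on. So the cuts `(B, R)` and `(B, B)` suffice.
  have hmaps : ∀ v ∈ (Finset.univ : Finset V), pos rank v / m ∈ Finset.range M := by
    intro v _
    rw [Finset.mem_range, Nat.div_lt_iff_lt_mul hm]
    exact (pos_lt_card v).trans_le hMm
  rw [← Finset.sum_fiberwise_of_maps_to hmaps]
  have hb : ∀ b ∈ Finset.range M, ∑ v ∈ Finset.univ.filter (fun v => pos rank v / m = b),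
      |(nbrs G (Finset.univ.filter fun u => rank v < rank u) v : ℝ) -
        p * ((n : ℝ) - pos rank v)| ≤ 3 * Δ + 2 * p * m ^ 2 := by
    intro b _
    set B := Finset.univ.filter (fun v => pos rank v / m = b) with hB
    set R := Finset.univ.filter (fun v => b * m ≤ pos rank v) with hR
    have hBm : ∀ v ∈ B, b * m ≤ pos rank v ∧ pos rank v < b * m + m := by
      intro v hv
      have := (Finset.mem_filter.1 hv).2
      have h1 := (Nat.div_eq_iff hm).1 this
      constructor <;> omega
    have hBcard : B.card ≤ m := by
      have : B.card = (B.image (pos rank)).card :=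
        (Finset.card_image_of_injective _ (pos_injective h)).symm
      rw [this]
      calc _ ≤ (Finset.Ico (b * m) (b * m + m)).card := by
            refine Finset.card_le_card fun i hi => ?_
            obtain ⟨v, hv, rfl⟩ := Finset.mem_image.1 hi
            exact Finset.mem_Ico.2 (hBm v hv)
        _ = m := by simp
    have hRcard : ∀ v ∈ B, (R.card : ℝ) = n - (b * m : ℕ) := by
      intro v hv
      have h1 := (hBm v hv).1
      have h2 := pos_lt_card (rank := rank) v
      have : R.card = ((Finset.range n).filter (fun i => b * m ≤ i)).card := card_pos h _
      have e : (Finset.range n).filter (fun i => b * m ≤ i) = Finset.Ico (b * m) n := by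
        ext i; simp [and_comm]
      rw [this, e, Nat.card_Ico, Nat.cast_sub (by omega)]
    have hv : ∀ v ∈ B, |(nbrs G (Finset.univ.filter fun u => rank v < rank u) v : ℝ) -
        p * ((n : ℝ) - pos rank v)| ≤
        |(nbrs G R v : ℝ) - p * R.card| + nbrs G B v + p * m := by
      intro v hv
      have h1 : nbrs G (Finset.univ.filter fun u => rank v < rank u) v ≤ nbrs G R v := by
        refine nbrs_mono (fun u hu => ?_) v
        simp only [Finset.mem_filter, Finset.mem_univ, true_and, hR] at hu ⊢
        have := pos_lt_pos hu
        have := (hBm v hv).1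
        omega
      have h2 : nbrs G R v ≤
          nbrs G (Finset.univ.filter fun u => rank v < rank u) v + nbrs G B v := by
        refine nbrs_le_add (fun u hu => ?_) v
        simp only [Finset.mem_filter, Finset.mem_univ, true_and, hR, hB, Finset.mem_union] at hu ⊢
        by_cases hlt : rank v < rank u
        · exact Or.inl hlt
        · refine Or.inr ?_
          have h3 := mt pos_lt_pos_iff.1 hlt
          have := (hBm v hv).2
          rw [Nat.div_eq_iff hm]
          omega
      have h1' : (nbrs G (Finset.univ.filter fun u => rank v < rank u) v : ℝ) ≤ nbrs G R v := by
        exact_mod_cast h1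
      have h2' : (nbrs G R v : ℝ) ≤
          nbrs G (Finset.univ.filter fun u => rank v < rank u) v + nbrs G B v := by
        exact_mod_cast h2
      have h3 : ((b * m : ℕ) : ℝ) ≤ pos rank v := by exact_mod_cast (hBm v hv).1
      have h4 : (pos rank v : ℝ) ≤ (b * m : ℕ) + m := by exact_mod_cast (hBm v hv).2.le
      have h5 : p * (n - pos rank v) ≤ p * R.card := by
        rw [hRcard v hv]; gcongr
      have h6 : p * R.card ≤ p * (n - pos rank v) + p * m := by
        rw [hRcard v hv, ← mul_add]; gcongr; linarith
      have h7 := neg_abs_le ((nbrs G R v : ℝ) - p * R.card)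
      have h8 := le_abs_self ((nbrs G R v : ℝ) - p * R.card)
      have h9 : (0 : ℝ) ≤ nbrs G B v := by positivity
      have h10 : 0 ≤ p * m := by positivity
      rw [abs_le]
      constructor <;> linarith
    have h1 := hG.sum_abs_le B R
    have h2 := (abs_le.1 (hG B B)).2
    have h3 : (B.card : ℝ) ≤ m := by exact_mod_cast hBcard
    calc _ ≤ ∑ v ∈ B, (|(nbrs G R v : ℝ) - p * R.card| + nbrs G B v + p * m) :=
          Finset.sum_le_sum hv
      _ = ∑ v ∈ B, |(nbrs G R v : ℝ) - p * R.card| + ∑ v ∈ B, (nbrs G B v : ℝ) +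
          B.card * (p * m) := by
          rw [Finset.sum_add_distrib, Finset.sum_add_distrib, Finset.sum_const, nsmul_eq_mul]
      _ ≤ 2 * Δ + (p * m * m + Δ) + m * (p * m) := by
          have h4 : p * B.card * B.card ≤ p * m * m := by gcongr
          have h5 : B.card * (p * m) ≤ m * (p * m) := by gcongr
          linarith
      _ = _ := by ring
  calc _ ≤ ∑ b ∈ Finset.range M, (3 * Δ + 2 * p * m ^ 2) := Finset.sum_le_sum hb
    _ = _ := by rw [Finset.sum_const, Finset.card_range, nsmul_eq_mul]

end Position

end Brushing

namespace Brushing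

/-! ### The potential for Min's strategy -/

section Potential

open Real

/-- The potential of the limiting game in which `E` counts the ordered dirty edges and `B` the
total load of the dirty vertices. -/
noncomputable def pot (E B : ℝ) : ℝ := E - B + E * exp (B / E - 2)

theorem pot_nonneg {E B : ℝ} (hE : 0 < E) : 0 ≤ pot E B := by
  have h := mul_le_mul_of_nonneg_left (add_one_le_exp (B / E - 2)) hE.le
  have e : E * (B / E - 2 + 1) = B - E := by field_simp; ring
  unfold pot
  linarith

/-- `pot` is convex, being a linear function plus the perspective of an exponential. This is its
tangent plane at `(E', B')`, obtained from `x + 1 ≤ exp x`. -/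
theorem pot_tangent {E B E' B' z : ℝ} (hE : 0 < E) (hE' : 0 < E') (hz : z = 2 - B' / E') :
    pot E' B' + (E - E') * (1 + exp (-z) * (z - 1)) - (B - B') * (1 - exp (-z)) ≤ pot E B := by
  have h1 : exp (B / E - 2) = exp (-z) * exp (B / E - B' / E') := by
    rw [← exp_add]; congr 1; rw [hz]; ring
  have h2 := add_one_le_exp (B / E - B' / E')
  have h3 := mul_le_mul_of_nonneg_left h2 (mul_nonneg hE.le (exp_pos (-z)).le)
  have hB : B' = E' * (2 - z) := by rw [hz]; field_simp; ring
  have h4 : exp (B' / E' - 2) = exp (-z) := by congr 1; rw [hz]; ring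
  have h5 : E * exp (-z) * (B / E - B' / E' + 1) = exp (-z) * (B + E * (z - 1)) := by
    have : B' / E' = 2 - z := by rw [hz]; ring
    rw [this]; field_simp; ring
  unfold pot
  rw [h1, h4]
  rw [h5] at h3
  have h6 : E * (exp (-z) * exp (B / E - B' / E')) = E * exp (-z) * exp (B / E - B' / E') := by ring
  rw [h6]
  have h7 : exp (-z) * B' = exp (-z) * (E' * (2 - z)) := congrArg (exp (-z) * ·) hB
  linarith

/-- The slope in `B` is `-(1 - exp (B / E - 2))`. Hence only lower bounds on the remaining load are
needed below. -/
theorem pot_anti {E B B' : ℝ} (hE : 0 < E) (h : B' ≤ B) (hB : B ≤ 2 * E) :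
    pot E B ≤ pot E B' := by
  have h1 := pot_tangent (E := E) (B := B') (E' := E) (B' := B) hE hE rfl
  have h2 : exp (-(2 - B / E)) ≤ 1 := by
    rw [exp_le_one_iff, neg_nonpos, sub_nonneg, div_le_iff₀ hE]; exact hB
  nlinarith

/-- The expression vanishes at `0` and has derivative `1 - exp (-z) (1 + z) ≥ 0`. It is the
first-order gain in a saturated phase. -/
theorem le_exp_neg_mul {z : ℝ} (hz : 0 ≤ z) : 0 ≤ z - 2 + exp (-z) * (2 + z) := by
  have hd : ∀ x : ℝ, HasDerivAt (fun x => x - 2 + exp (-x) * (2 + x))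
      (1 - exp (-x) * (1 + x)) x := by
    intro x
    have h1 : HasDerivAt (fun x : ℝ => exp (-x)) (exp (-x) * (-1)) x :=
      (hasDerivAt_neg x).exp
    have h2 : HasDerivAt (fun x : ℝ => 2 + x) 1 x := (hasDerivAt_id x).const_add 2
    exact (((hasDerivAt_id x).sub_const 2).add (h1.mul h2)).congr_deriv (by ring)
  have hm : MonotoneOn (fun x : ℝ => x - 2 + exp (-x) * (2 + x)) (Set.Ici 0) := by
    refine monotoneOn_of_deriv_nonneg (convex_Ici 0)
      (fun x _ => (hd x).continuousAt.continuousWithinAt)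
      (fun x _ => (hd x).differentiableAt.differentiableWithinAt) fun x _ => ?_
    rw [(hd x).deriv, sub_nonneg, exp_neg, inv_mul_le_iff₀ (exp_pos x), mul_one, add_comm]
    exact add_one_le_exp x
  have := hm (Set.mem_Ici.2 le_rfl) (Set.mem_Ici.2 hz) hz
  simpa using this

/-- The usual phase, from `k + m` to `k` vertices: `W` and `W'` are the cut-off loads, `t` the
number of turns, `e` the cut error. To first order the tangent plane at the new point drops by `t -
q (t - 2 m p k z)` with `q = exp (-z)`. The bound `ht` says that `t` is at most about `2 m p k z`,
twice the missing load of `m` average vertices. -/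
theorem pot_step_unsaturated {p m k W W' t e : ℝ} (hp : 0 < p) (hm : 0 < m) (hk : m ≤ k)
    (he : 0 ≤ e) (hW : 0 ≤ W) (hW2 : W ≤ 2 * p * (k + m) ^ 2)
    (ht : t ≤ 2 * (m * (2 * p * (k + m)) - m * (W / (k + m))) + 4 * e + 1)
    (hW' : W + t - m * (2 * p * (k + m)) - (6 * e + 4 * p * m ^ 2 + 1) ≤ W')
    (hW'2 : W' ≤ 2 * (p * k ^ 2)) :
    pot (p * k ^ 2) W' + t ≤ pot (p * (k + m) ^ 2) W + (26 * p * m ^ 2 + 10 * e + 2) := by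
  have hk0 : 0 < k := hm.trans_le hk
  have hkm : 0 < k + m := by linarith
  set B := W + t - m * (2 * p * (k + m)) - (6 * e + 4 * p * m ^ 2 + 1) with hB
  have hE : 0 < p * k ^ 2 := by positivity
  refine le_trans (add_le_add_left (pot_anti hE hW' hW'2) t) ?_
  have htan := pot_tangent (E := p * (k + m) ^ 2) (B := W) (E' := p * k ^ 2) (B' := B)
    (by positivity) hE rfl
  set z := 2 - B / (p * k ^ 2) with hz
  have hz0 : 0 ≤ z := by
    rw [hz, sub_nonneg, div_le_iff₀ hE]; linarith
  set q := exp (-z) with hq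
  have hq0 : 0 < q := exp_pos _
  have hq1 : q ≤ 1 := by rw [hq, exp_le_one_iff]; linarith
  -- `t` is at most about `2 p m k z`
  have hX : 0 ≤ m * (W / (k + m)) := by positivity
  have hBW : B ≤ W + m * (2 * p * (k + m)) := by
    have : 0 ≤ p * m ^ 2 := by positivity
    linarith
  have hWk : W / k ≤ W / (k + m) + 4 * p * m := by
    rw [div_add' _ _ _ hkm.ne', div_le_div_iff₀ hk0 hkm]
    have h1 : W * m ≤ 2 * p * (k + m) ^ 2 * m := by gcongr
    have h2 : 2 * p * (k + m) ^ 2 * m ≤ 4 * p * m * (k + m) * k := by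
      have h3 : 0 ≤ p * m * (k + m) := by positivity
      nlinarith
    linarith
  have hmk : m * (2 * p * (k + m)) / k ≤ 4 * p * m := by
    rw [div_le_iff₀ hk0]
    have h3 : 0 ≤ p * m := by positivity
    nlinarith
  have hBk : B / k ≤ W / (k + m) + 8 * p * m := by
    calc B / k ≤ (W + m * (2 * p * (k + m))) / k := by gcongr
      _ = W / k + m * (2 * p * (k + m)) / k := add_div _ _ _
      _ ≤ _ := by linarith
  have hzk : p * k * z = 2 * p * k - B / k := by
    rw [hz]; field_simp
  have ht2 : t ≤ 2 * m * (p * k * z) + (20 * p * m ^ 2 + 4 * e + 1) := by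
    rw [hzk]
    have := mul_le_mul_of_nonneg_left hBk (by positivity : 0 ≤ 2 * m)
    linarith
  have h1 : q * (t - 2 * m * (p * k * z)) ≤ 20 * p * m ^ 2 + 4 * e + 1 := by
    have h2 : 0 ≤ 20 * p * m ^ 2 + 4 * e + 1 := by positivity
    by_cases h3 : 0 ≤ t - 2 * m * (p * k * z)
    · calc _ ≤ 1 * (t - 2 * m * (p * k * z)) := by gcongr
        _ ≤ _ := by linarith
    · have : q * (t - 2 * m * (p * k * z)) ≤ 0 :=
        mul_nonpos_of_nonneg_of_nonpos hq0.le (by linarith)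
      linarith
  have h4 : 0 ≤ p * m ^ 2 * (1 - q + q * z) := by
    have : 0 ≤ 1 - q + q * z := by nlinarith [mul_nonneg hq0.le hz0]
    positivity
  have h5 : 0 ≤ q * (6 * p * m ^ 2 + 6 * e + 1) := by positivity
  have e1 : (p * (k + m) ^ 2 - p * k ^ 2) * (1 + q * (z - 1)) - (W - B) * (1 - q) =
      t - q * (t - 2 * m * (p * k * z)) + p * m ^ 2 * (1 - q + q * z)
        - (1 - q) * (6 * p * m ^ 2 + 6 * e + 1) := by
    rw [hB]; ring
  have h7 : 0 ≤ p * m ^ 2 := by positivity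
  linarith [htan, e1, h1, h4, h5]

/-- Here the chosen vertices were almost full, so the phase is short. Lowering the cut-off scales
the load of the others by at worst `k / (k + m)`, and the first-order change is the nonnegative `p m
k (z - 2 + q (2 + z))`, where `q = exp (-z)`. -/
theorem pot_step_saturated {p m k W W' t e : ℝ} (hp : 0 < p) (hm : 0 < m) (hk : m ≤ k)
    (he : 0 ≤ e) (ht : t ≤ 4 * p * m ^ 2 + 4 * e + 1)
    (hW' : k * (W - m * (2 * p * (k + m)) - 2 * e) ≤ (k + m) * W')
    (hW'2 : W' ≤ 2 * (p * k ^ 2)) :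
    pot (p * k ^ 2) W' + t ≤ pot (p * (k + m) ^ 2) W + (26 * p * m ^ 2 + 10 * e + 2) := by
  have hk0 : 0 < k := hm.trans_le hk
  have hkm : 0 < k + m := by linarith
  set B := k * (W - m * (2 * p * (k + m)) - 2 * e) / (k + m) with hB
  have hBW : B ≤ W' := by rw [hB, div_le_iff₀ hkm]; linarith
  have hE : 0 < p * k ^ 2 := by positivity
  refine le_trans (add_le_add_left (pot_anti hE hBW hW'2) t) ?_
  have htan := pot_tangent (E := p * (k + m) ^ 2) (B := W) (E' := p * k ^ 2) (B' := B)
    (by positivity) hE rfl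
  set z := 2 - B / (p * k ^ 2) with hz
  have hz0 : 0 ≤ z := by
    rw [hz, sub_nonneg, div_le_iff₀ hE]; linarith
  have hq0 : 0 < exp (-z) := exp_pos _
  have hq1 : exp (-z) ≤ 1 := by rw [exp_le_one_iff]; linarith
  have hexp := le_exp_neg_mul hz0
  set q := exp (-z) with hq
  have hBz : B = p * k ^ 2 * (2 - z) := by rw [hz]; field_simp; ring
  have hWB : W - B = p * m * k * (4 - z) + 2 * p * m ^ 2 + 2 * e := by
    have h1 : W = B * (k + m) / k + m * (2 * p * (k + m)) + 2 * e := by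
      rw [hB]; field_simp; ring
    rw [h1, hBz]; field_simp; ring
  have h4 : 0 ≤ p * m ^ 2 * (1 - q + q * z) := by
    have : 0 ≤ 1 - q + q * z := by nlinarith [mul_nonneg hq0.le hz0]
    positivity
  have h5 : 0 ≤ q * (2 * p * m ^ 2 + 2 * e) := by positivity
  have h6 : 0 ≤ p * m * k * (z - 2 + q * (2 + z)) := by positivity
  have e1 : (p * (k + m) ^ 2 - p * k ^ 2) * (1 + q * (z - 1)) - (W - B) * (1 - q) =
      p * m * k * (z - 2 + q * (2 + z)) + p * m ^ 2 * (1 - q + q * z)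
        - (1 - q) * (2 * p * m ^ 2 + 2 * e) := by
    rw [hWB]; ring
  have h7 : 0 ≤ p * m ^ 2 := by positivity
  linarith [htan, e1, h4, h5, h6, h7]

end Potential

end Brushing

namespace Brushing

/-! ### Vertices of largest load -/

section TopSubset

variable {V : Type*} [DecidableEq V]

theorem exists_top_subset (f : V → ℝ) (D : Finset V) (m : ℕ) (hm : m ≤ D.card) :
    ∃ S ⊆ D, S.card = m ∧ ∀ x ∈ S, ∀ y ∈ D \ S, f y ≤ f x := by
  induction m with
  | zero => exact ⟨∅, by simp, by simp, by simp⟩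
  | succ m ih =>
    obtain ⟨S, hS, hc, htop⟩ := ih (by omega)
    have hne : (D \ S).Nonempty := by
      rw [← Finset.card_pos, Finset.card_sdiff_of_subset hS]; omega
    obtain ⟨x, hx, hmax⟩ := Finset.exists_max_image (D \ S) f hne
    have hx' := Finset.mem_sdiff.1 hx
    refine ⟨insert x S, Finset.insert_subset hx'.1 hS, by simp [hx'.2, hc], ?_⟩
    intro a ha y hy
    have hy' : y ∈ D \ S := by
      simp only [Finset.mem_sdiff, Finset.mem_insert, not_or] at hy ⊢
      exact ⟨hy.1, hy.2.2⟩
    rcases Finset.mem_insert.1 ha with rfl | ha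
    · exact hmax y hy'
    · exact htop a ha y hy'

theorem mul_sum_le_of_top {f : V → ℝ} {D S : Finset V} (hS : S ⊆ D)
    (h : ∀ x ∈ S, ∀ y ∈ D \ S, f y ≤ f x) :
    S.card * ∑ v ∈ D, f v ≤ D.card * ∑ v ∈ S, f v := by
  have h1 : ∑ x ∈ S, ∑ y ∈ D \ S, f y ≤ ∑ x ∈ S, ∑ y ∈ D \ S, f x :=
    Finset.sum_le_sum fun x hx => Finset.sum_le_sum fun y hy => h x hx y hy
  simp only [Finset.sum_const, nsmul_eq_mul, ← Finset.mul_sum] at h1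
  have h2 : ((D \ S).card : ℝ) = D.card - S.card := by
    rw [Finset.card_sdiff_of_subset hS, Nat.cast_sub (Finset.card_le_card hS)]
  have h3 := Finset.sum_sdiff (f := f) hS
  rw [h2] at h1
  rw [← h3]
  linarith

end TopSubset

/-! ### The upper bound: Min's strategy in phases -/

section Upper

variable {V : Type*} [Fintype V] [DecidableEq V] {G : SimpleGraph V}

open Classical in
/-- The load of a vertex, cut off at the value `2 p |D|` at which it is expected to fire when the
dirty set is `D`. Clean vertices count as fully loaded. -/
noncomputable def cutLoad (G : SimpleGraph V) (p : ℝ) (D : Finset V) (s : State V) (v : V) : ℝ :=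
  if v ∈ s.dirty then min (load G s v : ℝ) (2 * p * D.card) else 2 * p * D.card

theorem cutLoad_le (p : ℝ) (D : Finset V) (s : State V) (v : V) :
    cutLoad G p D s v ≤ 2 * p * D.card := by
  unfold cutLoad; split_ifs
  · exact min_le_right _ _
  · exact le_rfl

theorem cutLoad_nonneg {p : ℝ} (hp : 0 ≤ p) (D : Finset V) (s : State V) (v : V) :
    0 ≤ cutLoad G p D s v := by
  unfold cutLoad; split_ifs <;> positivity

theorem sum_cutLoad_le (p : ℝ) (D : Finset V) (s : State V) :
    ∑ v ∈ D, cutLoad G p D s v ≤ 2 * (p * D.card ^ 2) := by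
  calc _ ≤ ∑ v ∈ D, (2 * p * D.card : ℝ) := Finset.sum_le_sum fun v _ => cutLoad_le p D s v
    _ = _ := by rw [Finset.sum_const, nsmul_eq_mul]; ring

/-- Climbing `a` before losing anything and losing at most `b`, a vertex wastes the largest share of
its `c` brushes when `c = a + b`. -/
theorem min_sub_le_div {a b c : ℝ} (ha : 0 < a) (hb : 0 ≤ b) :
    min b (c - a) ≤ c * b / (a + b) := by
  have hab : 0 < a + b := by linarith
  rw [le_div_iff₀ hab]
  rcases le_total b (c - a) with h | h
  · rw [min_eq_left h]; nlinarith
  · rw [min_eq_right h]; nlinarith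

set_option maxHeartbeats 1000000 in
/-- One phase of Min's strategy: he cleans `m` vertices of largest load. -/
theorem exists_phase {p Δ : ℝ} (hG : CutBound G p Δ) (hp : 0 < p) {s : State V}
    (hs : Stable G s) (P : Player) {D : Finset V} (hD : s.dirty ⊆ D) {m : ℕ} (hm : 0 < m)
    (hmD : 2 * m ≤ D.card) :
    ∃ (s' : State V) (P' : Player) (D' : Finset V), Stable G s' ∧ s'.dirty ⊆ D' ∧
      D'.card + m = D.card ∧
      gameLength G P s + pot (p * D'.card ^ 2) (∑ v ∈ D', cutLoad G p D' s' v) ≤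
        gameLength G P' s' + pot (p * D.card ^ 2) (∑ v ∈ D, cutLoad G p D s v) +
          (26 * p * m ^ 2 + 20 * Δ + 2) := by
  obtain ⟨S, hSD, hSc, htop⟩ := exists_top_subset (cutLoad G p D s) D m (by omega)
  obtain ⟨s', P', cnt, hs', hsub, hdisj, hcnt, hload, hlen, hgame⟩ :=
    exists_play_cleaning G S P s hs
  set D' := D \ S with hD'
  have hcard : D'.card + m = D.card := by
    rw [hD', Finset.card_sdiff_of_subset hSD]; omega
  refine ⟨s', P', D', hs', ?_, hcard, ?_⟩
  · intro v hv
    exact Finset.mem_sdiff.2 ⟨hD (hsub hv), fun h => Finset.disjoint_left.1 hdisj h hv⟩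
  set w := cutLoad G p D s with hw
  set dev : V → ℝ := fun v => |(nbrs G D v : ℝ) - p * D.card| with hdev
  set k : ℝ := (D'.card : ℝ) with hk
  have hkm : (D.card : ℝ) = k + m := by rw [← hcard]; push_cast; rfl
  have hmR : (0 : ℝ) < m := by exact_mod_cast hm
  have hkm' : (m : ℝ) ≤ k := by rw [hk]; exact_mod_cast (by omega : m ≤ D'.card)
  have hk0 : 0 < k := hmR.trans_le hkm'
  set t : ℝ := ∑ v, (cnt v : ℝ) with ht
  have hdevS : ∀ A : Finset V, ∑ v ∈ A, dev v ≤ 2 * Δ := fun A => hG.sum_abs_le A D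
  have hΔ := hG.nonneg
  set c : ℝ := 2 * p * D.card with hc
  have hcnt0 : ∀ v ∉ D, cnt v = 0 := by
    intro v hv
    by_contra h
    exact hv (hD (hcnt v (by omega)).1)
  -- A vertex takes brushes only up to twice its dirty degree, which is at most `c / 2 + dev v`.
  have hbound : ∀ v ∈ D, w v + cnt v ≤ c + 2 * dev v := by
    intro v _
    have hd : 0 ≤ dev v := abs_nonneg _
    by_cases h : 0 < cnt v
    · obtain ⟨h1, h2⟩ := hcnt v h
      have h3 : (dirtyNbrs G s v).card ≤ nbrs G D v := nbrs_mono (G := G) hD v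
      have h4 : (load G s v : ℝ) + cnt v ≤ 2 * nbrs G D v := by
        exact_mod_cast h2.trans (by omega)
      have h5 : w v ≤ load G s v := by
        rw [hw]; unfold cutLoad; rw [if_pos h1]; exact min_le_left _ _
      have h6 : (nbrs G D v : ℝ) - p * D.card ≤ dev v := le_abs_self _
      rw [hc]; linarith
    · have h0 : cnt v = 0 := by omega
      have := cutLoad_le (G := G) p D s v
      rw [h0]; push_cast; linarith
  have htD : t = ∑ v ∈ D, (cnt v : ℝ) := by
    rw [ht]; symm
    refine Finset.sum_subset (Finset.subset_univ _) fun v _ hv => ?_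
    simp [hcnt0 v hv]
  have hcntS : ∑ v ∈ S, (cnt v : ℝ) ≤ m * c - ∑ v ∈ S, w v + 4 * Δ := by
    have h1 : ∑ v ∈ S, (w v + cnt v) ≤ ∑ v ∈ S, (c + 2 * dev v) :=
      Finset.sum_le_sum fun v hv => hbound v (hSD hv)
    rw [Finset.sum_add_distrib, Finset.sum_add_distrib, Finset.sum_const, nsmul_eq_mul, hSc,
      ← Finset.mul_sum] at h1
    linarith [hdevS S]
  have hlen' : t ≤ 2 * ∑ v ∈ S, (cnt v : ℝ) + 1 := by
    have h1 : ∑ v, cnt v ≤ 2 * ∑ v ∈ S, cnt v + 1 := by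
      refine hlen.trans ?_
      cases P <;> simp
    rw [ht]; exact_mod_cast h1
  have htS : t ≤ 2 * (m * c - ∑ v ∈ S, w v) + 8 * Δ + 1 := by linarith
  have hgame' : (gameLength G P s : ℝ) ≤ t + gameLength G P' s' := by
    rw [ht]; exact_mod_cast hgame
  -- what remains after the phase, before cutting off at the new threshold
  set y : V → ℝ := fun v => min (w v + cnt v) c with hy
  have hw0 : ∀ v, 0 ≤ w v := fun v => cutLoad_nonneg hp.le D s v
  have hc0 : 0 ≤ c := by positivity
  have hy0 : ∀ v, 0 ≤ y v := fun v => le_min (add_nonneg (hw0 v) (Nat.cast_nonneg _)) hc0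
  have hysum : ∑ v ∈ D, w v + t - m * c - 4 * Δ ≤ ∑ v ∈ D', y v := by
    have h1 : ∑ v ∈ D', (w v + cnt v - 2 * dev v) ≤ ∑ v ∈ D', y v := by
      refine Finset.sum_le_sum fun v hv => le_min ?_ ?_
      · have : 0 ≤ dev v := abs_nonneg _
        linarith
      · linarith [hbound v (Finset.mem_sdiff.1 hv).1]
    have h2 : ∑ v ∈ S, (w v + cnt v - 2 * dev v) ≤ m * c := by
      calc _ ≤ ∑ v ∈ S, c := Finset.sum_le_sum fun v hv => by linarith [hbound v (hSD hv)]
        _ = m * c := by rw [Finset.sum_const, nsmul_eq_mul, hSc]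
    have h3 := Finset.sum_sdiff (f := fun v => w v + cnt v - 2 * dev v) hSD
    have h4 : ∑ v ∈ D, (w v + cnt v - 2 * dev v) = ∑ v ∈ D, w v + t - 2 * ∑ v ∈ D, dev v := by
      rw [Finset.sum_sub_distrib, Finset.sum_add_distrib, ← Finset.mul_sum, htD]
    linarith [hdevS D]
  set c' : ℝ := 2 * p * D'.card with hc'
  have hcc' : c = c' + 2 * p * m := by rw [hc, hc', hkm]; ring
  have hW' : ∑ v ∈ D', min (y v) c' ≤ ∑ v ∈ D', cutLoad G p D' s' v := by
    refine Finset.sum_le_sum fun v hv => ?_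
    unfold cutLoad
    split_ifs with hvd
    · refine min_le_min ((min_le_left _ _).trans ?_) le_rfl
      have h5 : w v ≤ load G s v := by
        rw [hw]; unfold cutLoad; rw [if_pos (hsub hvd)]; exact min_le_left _ _
      rw [hload v hvd]; push_cast; linarith
    · exact min_le_right _ _
  have hW'2 := sum_cutLoad_le (G := G) p D' s'
  set W' := ∑ v ∈ D', cutLoad G p D' s' v
  have hne : S.Nonempty := by rw [← Finset.card_pos]; omega
  obtain ⟨x, hxS, hxmin⟩ := Finset.exists_min_image S w hne
  have hXx : m * w x ≤ ∑ v ∈ S, w v := by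
    rw [← hSc, ← nsmul_eq_mul]; exact Finset.card_nsmul_le_sum S w (w x) hxmin
  have hstep : pot (p * k ^ 2) W' + t ≤ pot (p * (k + m) ^ 2) (∑ v ∈ D, w v) +
      (26 * p * m ^ 2 + 10 * (2 * Δ) + 2) := by
    have hck : c = 2 * p * (k + m) := by rw [hc, hkm]
    have hc'k : c' = 2 * p * k := rfl
    -- Either all of `S` has reached the next threshold `c'`, and the phase is short, or `w x < c'`,
    -- and then every vertex outside `S` is also below `c'`, because `S` has the largest loads.
    by_cases hsat : c' ≤ w x
    · have h1 : m * c' ≤ m * w x := by gcongr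
      refine pot_step_saturated hp hmR hkm' (by positivity) ?_ ?_ hW'2
      · rw [hcc'] at htS; linarith
      · have h2 : ∀ v ∈ D', k * y v ≤ (k + m) * min (y v) c' := by
          intro v _
          rcases le_total (y v) c' with h | h
          · rw [min_eq_left h]; nlinarith [hy0 v]
          · rw [min_eq_right h]
            have : y v ≤ c := min_le_right _ _
            calc k * y v ≤ k * c := by gcongr
              _ = (k + m) * c' := by rw [hck, hc'k]; ring
        have h3 := Finset.sum_le_sum h2
        rw [← Finset.mul_sum, ← Finset.mul_sum] at h3
        have h4 : (k + m) * ∑ v ∈ D', min (y v) c' ≤ (k + m) * W' := by gcongr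
        have h5 : k * (∑ v ∈ D, w v - m * (2 * p * (k + m)) - 2 * (2 * Δ)) ≤
            k * ∑ v ∈ D', y v := by
          have ht0 : 0 ≤ t := by positivity
          rw [hck] at hysum
          gcongr; linarith
        linarith
    · push Not at hsat
      have hcx : 2 * p * m ≤ c - w x := by linarith
      have hcx0 : 0 < c - w x := by
        have : 0 < 2 * p * m := by positivity
        linarith
      -- A vertex outside `S` starts at load at most `w x`, so at most the fraction `2 p m / (c - w
      -- x)` of its brushes is cut off. As `t` is at most about `2 m (c - w x)`, the total loss is
      -- only about `4 p m ^ 2`.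
      have hloss : ∀ v ∈ D', y v - cnt v * (2 * p * m) / (c - w x) ≤ min (y v) c' := by
        intro v hv
        have h0 : 0 ≤ (cnt v : ℝ) * (2 * p * m) / (c - w x) := by positivity
        rcases le_total (y v) c' with h | h
        · rw [min_eq_left h]; linarith
        · rw [min_eq_right h]
          have h1 := min_sub_le_div (a := c' - w x) (b := 2 * p * m) (c := cnt v)
            (by linarith) (by positivity)
          have e : c' - w x + 2 * p * m = c - w x := by linarith
          rw [e] at h1
          have h2 : y v - c' ≤ min (2 * p * m) (cnt v - (c' - w x)) := by
            refine le_min ?_ ?_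
            · have : y v ≤ c := min_le_right _ _
              linarith
            · have h3 : y v ≤ w v + cnt v := min_le_left _ _
              linarith [htop x hxS v hv]
          linarith
      have hsum := Finset.sum_le_sum hloss
      rw [Finset.sum_sub_distrib, ← Finset.sum_div, ← Finset.sum_mul] at hsum
      have hcntD' : ∑ v ∈ D', (cnt v : ℝ) ≤ t := by
        rw [ht]
        exact Finset.sum_le_sum_of_subset_of_nonneg (Finset.subset_univ _) fun _ _ _ => by positivity
      have htx : t ≤ 2 * m * (c - w x) + 8 * Δ + 1 := by nlinarith
      have hl : (∑ v ∈ D', (cnt v : ℝ)) * (2 * p * m) / (c - w x) ≤ 4 * p * m ^ 2 + 8 * Δ + 1 := by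
        rw [div_le_iff₀ hcx0]
        have h1 : (∑ v ∈ D', (cnt v : ℝ)) * (2 * p * m) ≤
            (2 * m * (c - w x) + 8 * Δ + 1) * (2 * p * m) := by
          gcongr; linarith
        have h2 : (8 * Δ + 1) * (2 * p * m) ≤ (8 * Δ + 1) * (c - w x) := by gcongr
        linarith
      have hWD := mul_sum_le_of_top hSD htop
      rw [hSc, hkm] at hWD
      refine pot_step_unsaturated hp hmR hkm' (by positivity) (Finset.sum_nonneg fun v _ => hw0 v)
        ?_ ?_ ?_ hW'2
      · have := sum_cutLoad_le (G := G) p D s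
        rw [hkm] at this
        linarith
      · rw [← hck]
        have h1 : m * ((∑ v ∈ D, w v) / (k + m)) ≤ ∑ v ∈ S, w v := by
          rw [← mul_div_assoc, div_le_iff₀ (by linarith)]; linarith
        linarith
      · rw [← hck]
        linarith
  rw [hkm]
  linarith

/-- The upper bound for the game brush number, with explicit error terms. -/
theorem gameBrushNumber_le {p Δ : ℝ} (hG : CutBound G p Δ) (hp : 0 < p) {m M : ℕ} (hm : 0 < m)
    (hM : 0 < M) (hmM : M * m ≤ Fintype.card V) :
    (gameBrushNumber G : ℝ) ≤ p * (Fintype.card V : ℝ) ^ 2 * Real.exp (-1) +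
      M * (26 * p * m ^ 2 + 20 * Δ + 2) +
      2 * p * ((Fintype.card V : ℝ) - (M - 1) * m) ^ 2 + 4 * Δ := by
  set n := Fintype.card V with hn
  have hΔ := hG.nonneg
  have hiter : ∀ j : ℕ, j + 1 ≤ M → ∃ (s : State V) (P : Player) (D : Finset V), Stable G s ∧
      s.dirty ⊆ D ∧ D.card + j * m = n ∧
      gameBrushNumber G + pot (p * D.card ^ 2) (∑ v ∈ D, cutLoad G p D s v) ≤
        gameLength G P s + pot (p * n ^ 2)
          (∑ v, cutLoad G p Finset.univ (initial G) v) + j * (26 * p * m ^ 2 + 20 * Δ + 2) := by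
    intro j
    induction j with
    | zero =>
      intro _
      refine ⟨initial G, .min, Finset.univ, stable_initial G, Finset.subset_univ _,
        by simp [hn, Finset.card_univ], ?_⟩
      rw [Finset.card_univ, ← hn]
      simp [gameBrushNumber]
    | succ j ih =>
      intro hj
      obtain ⟨s, P, D, h1, h2, h3, h4⟩ := ih (by omega)
      have h2m : 2 * m ≤ D.card := by
        have : (j + 2) * m ≤ M * m := Nat.mul_le_mul_right m (by omega)
        have e : (j + 2) * m = j * m + 2 * m := by ring
        omega
      obtain ⟨s', P', D', g1, g2, g3, g4⟩ := exists_phase hG hp h1 P h2 hm h2m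
      refine ⟨s', P', D', g1, g2, ?_, ?_⟩
      · rw [Nat.succ_mul]; omega
      · push_cast
        linarith
  -- Only `M - 1` phases, since each phase needs `2 * m ≤ D.card`. The rest is cleaned at the crude
  -- cost of at most twice the dirty degree for each vertex.
  obtain ⟨s, P, D, h1, h2, h3, h4⟩ := hiter (M - 1) (by omega)
  have hn0 : 0 < n := by
    have := Nat.mul_pos hM hm
    omega
  have hDcard : (D.card : ℝ) = n - (M - 1) * m := by
    have h5 : ((D.card + (M - 1) * m : ℕ) : ℝ) = n := by exact_mod_cast h3
    push_cast [Nat.cast_sub (Nat.one_le_iff_ne_zero.2 hM.ne')] at h5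
    linarith
  have hD0 : 0 < D.card := by
    have e : M * m = (M - 1) * m + m := by
      obtain ⟨M', rfl⟩ : ∃ M', M = M' + 1 := ⟨M - 1, by omega⟩
      simp; ring
    omega
  have hend : (gameLength G P s : ℝ) ≤ 2 * (p * D.card ^ 2 + Δ) := by
    obtain ⟨s', P', cnt, g1, g2, g3, g4, -, -, g7⟩ :=
      exists_play_cleaning G Finset.univ P s h1
    have hempty : s'.dirty = ∅ := by
      rw [Finset.eq_empty_iff_forall_notMem]
      exact fun v hv => Finset.disjoint_left.1 g3 (Finset.mem_univ v) hv
    rw [gameLength_of_dirty_eq_empty G hempty] at g7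
    have h5 : ∑ v, cnt v ≤ ∑ v ∈ D, 2 * nbrs G D v := by
      rw [← Finset.sum_subset (Finset.subset_univ D) fun v _ hv => ?_]
      · refine Finset.sum_le_sum fun v _ => ?_
        by_cases h : 0 < cnt v
        · have h6 := (g4 v h).2
          have h7 : (dirtyNbrs G s v).card ≤ nbrs G D v := nbrs_mono (G := G) h2 v
          omega
        · omega
      · by_contra h
        exact hv (h2 (g4 v (by omega)).1)
    have h6 : (gameLength G P s : ℝ) ≤ 2 * ∑ v ∈ D, (nbrs G D v : ℝ) := by
      rw [Finset.mul_sum]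
      exact_mod_cast g7.trans (by simpa using h5)
    have h7 := (abs_le.1 (hG D D)).2
    nlinarith
  have hpos : 0 ≤ pot (p * D.card ^ 2) (∑ v ∈ D, cutLoad G p D s v) :=
    pot_nonneg (by positivity)
  have hE : 0 < p * (n : ℝ) ^ 2 := by positivity
  have hinit : pot (p * n ^ 2) (∑ v, cutLoad G p Finset.univ (initial G) v) ≤
      p * (n : ℝ) ^ 2 * Real.exp (-1) + 2 * Δ := by
    have hle := sum_cutLoad_le (G := G) p Finset.univ (initial G)
    rw [Finset.card_univ, ← hn] at hle
    have hge : p * (n : ℝ) ^ 2 - 2 * Δ ≤ ∑ v, cutLoad G p Finset.univ (initial G) v := by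
      have h5 : ∀ v ∈ (Finset.univ : Finset V), p * n - |(nbrs G Finset.univ v : ℝ) - p * n| ≤
          cutLoad G p Finset.univ (initial G) v := by
        intro v _
        have hpn : 0 ≤ p * n := by positivity
        have habs := abs_nonneg ((nbrs G Finset.univ v : ℝ) - p * n)
        unfold cutLoad
        rw [Finset.card_univ, ← hn]
        split_ifs with hv
        · have hload : load G (initial G) v = nbrs G Finset.univ v := by
            rw [initial, load_stabilize G _ hv]
            simp [load, nbrs, dirtyNbrs]
          rw [hload]
          refine le_min ?_ (by linarith)
          linarith [neg_abs_le ((nbrs G Finset.univ v : ℝ) - p * n)]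
        · linarith
      have h6 := Finset.sum_le_sum h5
      rw [Finset.sum_sub_distrib, Finset.sum_const, nsmul_eq_mul, Finset.card_univ, ← hn] at h6
      have h7 := hG.sum_abs_le Finset.univ Finset.univ
      rw [Finset.card_univ, ← hn] at h7
      linarith
    -- The initial loads are the degrees, so `B` is about `E` and the exponent `B / E - 2` is about
    -- `-1`. This is the source of the constant `1 / e`.
    refine (pot_anti hE hge hle).trans ?_
    unfold pot
    have h8 : Real.exp ((p * (n : ℝ) ^ 2 - 2 * Δ) / (p * n ^ 2) - 2) ≤ Real.exp (-1) := by
      rw [Real.exp_le_exp]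
      have : (p * (n : ℝ) ^ 2 - 2 * Δ) / (p * n ^ 2) ≤ 1 := by
        rw [div_le_one hE]; linarith
      linarith
    have := mul_le_mul_of_nonneg_left h8 hE.le
    linarith
  have hR : ((M - 1 : ℕ) : ℝ) * (26 * p * m ^ 2 + 20 * Δ + 2) ≤
      M * (26 * p * m ^ 2 + 20 * Δ + 2) := by
    gcongr; omega
  rw [hDcard] at hend
  linarith

end Upper

end Brushing

namespace Brushing

/-! ### Levels and truncated height in a least-load play -/

section PlayFacts

/-- Turns are numbered from `0`, so Min has the even ones. He can be one move ahead only if the last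
turn `b - 1` is his. -/
theorem card_even_Ico_le (a b : ℕ) :
    ((Finset.Ico a b).filter (¬ Odd ·)).card ≤ ((Finset.Ico a b).filter Odd).card + b % 2 := by
  induction b with
  | zero => simp
  | succ b ih =>
    by_cases hab : a ≤ b
    · rw [← Finset.insert_Ico_right_eq_Ico_add_one hab, Finset.filter_insert, Finset.filter_insert]
      by_cases hb : Odd b
      · have := Nat.odd_iff.1 hb
        simp only [hb, not_true_eq_false, if_false, if_true]
        rw [Finset.card_insert_of_notMem (by simp)]
        omega
      · have := Nat.not_odd_iff.1 hb
        simp only [hb, not_false_eq_true, if_false, if_true]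
        rw [Finset.card_insert_of_notMem (by simp)]
        omega
    · rw [Finset.Ico_eq_empty_of_le (by omega)]; simp

variable {V : Type*} [Fintype V] [DecidableEq V] {G : SimpleGraph V} (φ : MaxPlay G)

/-- The degree of `v` plus the number of brushes put on `v` in the first `i` turns. -/
noncomputable def MaxPlay.w (i : ℕ) (v : V) : ℕ :=
  nbrs G Finset.univ v + ((Finset.range i).filter (φ.mv · = v)).card

namespace MaxPlay

theorem w_succ (i : ℕ) (v : V) : φ.w (i + 1) v = φ.w i v + if φ.mv i = v then 1 else 0 := by
  unfold w
  rw [Finset.range_add_one, Finset.filter_insert]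
  by_cases h : φ.mv i = v
  · simp [h]; omega
  · simp [h]

theorem w_mono {i j : ℕ} (h : i ≤ j) (v : V) : φ.w i v ≤ φ.w j v :=
  monotone_nat_of_le_succ (f := fun i => φ.w i v)
    (fun i => by simp only [w_succ]; omega) h

theorem dirty_subset {i j : ℕ} (h : i ≤ j) (hj : j ≤ φ.T) : φ.dirty j ⊆ φ.dirty i := by
  induction j, h using Nat.le_induction with
  | base => exact subset_rfl
  | succ j hij ih => exact (φ.dirty_anti j (by omega)).trans (ih (by omega))

theorem w_eq_of_notMem {i : ℕ} (hi : i ≤ φ.T) {v : V} (hv : v ∉ φ.dirty i) :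
    φ.w φ.T v = φ.w i v := by
  have : ∀ j, i ≤ j → j ≤ φ.T → φ.w j v = φ.w i v := by
    intro j hij
    induction j, hij using Nat.le_induction with
    | base => exact fun _ => rfl
    | succ j hij ih =>
      intro hj
      rw [w_succ, ih (by omega), if_neg, add_zero]
      rintro rfl
      exact hv (φ.dirty_subset hij (by omega) (φ.mv_mem j (by omega)))
  exact this φ.T hi le_rfl

theorem sum_w (i : ℕ) : ∑ v, φ.w i v = ∑ v, nbrs G Finset.univ v + i := by
  induction i with
  | zero => simp [w]
  | succ i ih =>
    simp only [w_succ, Finset.sum_add_distrib, ih]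
    simp
    omega

/-- The number of vertices with load more than `h`. -/
noncomputable def c (t h : ℕ) : ℕ := (Finset.univ.filter fun v => h < φ.w t v).card

theorem c_le_card (t h : ℕ) : φ.c t h ≤ Fintype.card V := Finset.card_le_univ _

theorem c_anti (t : ℕ) {h h' : ℕ} (hh : h ≤ h') : φ.c t h' ≤ φ.c t h := by
  refine Finset.card_le_card fun v hv => ?_
  simp only [Finset.mem_filter, Finset.mem_univ, true_and] at hv ⊢
  omega

theorem c_succ_le (t h : ℕ) :
    φ.c (t + 1) h ≤ φ.c t h + if φ.w t (φ.mv t) = h then 1 else 0 := by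
  by_cases hh : φ.w t (φ.mv t) = h
  · rw [if_pos hh]
    refine (Finset.card_le_card (t := insert (φ.mv t)
      (Finset.univ.filter fun v => h < φ.w t v)) fun v hv => ?_).trans (Finset.card_insert_le _ _)
    simp only [Finset.mem_filter, Finset.mem_univ, true_and, Finset.mem_insert, w_succ] at hv ⊢
    by_cases hm : φ.mv t = v
    · exact Or.inl hm.symm
    · rw [if_neg hm] at hv; exact Or.inr hv
  · rw [if_neg hh]
    refine Finset.card_le_card fun v hv => ?_
    simp only [Finset.mem_filter, Finset.mem_univ, true_and, w_succ] at hv ⊢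
    by_cases hm : φ.mv t = v
    · subst hm; rw [if_pos rfl] at hv; omega
    · rw [if_neg hm] at hv; exact hv

theorem exists_level (ℓ : ℕ) : ∃ t, ∀ u ∈ φ.dirty t, ℓ ≤ φ.w t u := ⟨φ.T, by simp [φ.dirty_T]⟩

open Classical in
/-- The first time at which all dirty vertices have load at least `ℓ`. -/
noncomputable def τ (ℓ : ℕ) : ℕ := Nat.find (φ.exists_level ℓ)

theorem τ_le (ℓ : ℕ) : φ.τ ℓ ≤ φ.T := by
  classical
  exact Nat.find_min' _ (by simp [φ.dirty_T])

theorem le_w_of_τ_le {ℓ t : ℕ} (h : φ.τ ℓ ≤ t) (ht : t ≤ φ.T) {u : V} (hu : u ∈ φ.dirty t) :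
    ℓ ≤ φ.w t u := by
  classical
  exact (Nat.find_spec (φ.exists_level ℓ) u (φ.dirty_subset h ht hu)).trans (φ.w_mono h u)

theorem τ_mono {ℓ ℓ' : ℕ} (h : ℓ ≤ ℓ') : φ.τ ℓ ≤ φ.τ ℓ' := by
  classical
  exact Nat.find_min' _ fun u hu =>
    h.trans (φ.le_w_of_τ_le le_rfl (φ.τ_le ℓ') hu)

/-- Before time `τ ℓ` some dirty vertex has load below `ℓ`, and Max plays on one of least load. -/
theorem w_mv_lt {ℓ t : ℕ} (h : t < φ.τ ℓ) (ho : Odd t) : φ.w t (φ.mv t) < ℓ := by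
  classical
  have h1 := Nat.find_min (φ.exists_level ℓ) h
  push Not at h1
  obtain ⟨u, hu, hlt⟩ := h1
  exact (φ.mv_min t (h.trans_le (φ.τ_le ℓ)) ho u hu).trans_lt hlt

/-- The number of moves of Max while the least load rises from `a` to `b`. -/
theorem card_odd_le {t₁ t₂ a b : ℕ}
    (h : ∀ i ∈ Finset.Ico t₁ t₂, Odd i → φ.w i (φ.mv i) ∈ Finset.Ico a b) :
    ((Finset.Ico t₁ t₂).filter Odd).card ≤
      ∑ k ∈ Finset.Ico a b, (Finset.univ.filter fun v => φ.w t₁ v ≤ k).card := by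
  rw [← Finset.card_sigma]
  -- The load of a vertex grows with each brush on it, so a move is determined by the vertex and its
  -- load at that time.
  refine Finset.card_le_card_of_injOn (fun i => ⟨φ.w i (φ.mv i), φ.mv i⟩) ?_ ?_
  · intro i hi
    obtain ⟨hi, ho⟩ := Finset.mem_filter.1 (Finset.mem_coe.1 hi)
    refine Finset.mem_coe.2 (Finset.mem_sigma.2 ⟨h i hi ho, ?_⟩)
    simpa using φ.w_mono (Finset.mem_Ico.1 hi).1 _
  · have key : ∀ i j, i < j → φ.mv i = φ.mv j → φ.w i (φ.mv i) < φ.w j (φ.mv j) := by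
      intro i j hij hm
      rw [← hm]
      refine lt_of_lt_of_le ?_ (φ.w_mono (Nat.succ_le_of_lt hij) _)
      rw [Nat.succ_eq_add_one, w_succ]; simp
    intro i _ j _ hij
    simp only [Sigma.mk.injEq, heq_eq_eq] at hij
    rcases lt_trichotomy i j with h1 | h1 | h1
    · have := key i j h1 hij.2; omega
    · exact h1
    · have := key j i h1 hij.2.symm; omega

/-- The total height above `a` of the loads, cut off at `2 p (n - i)` for the vertex of `i`-th
largest load. -/
noncomputable def S (p : ℝ) (t a : ℕ) : ℝ :=
  ∑ h ∈ Finset.Ico a ⌈2 * p * Fintype.card V⌉₊,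
    min (φ.c t h : ℝ) (Fintype.card V - h / (2 * p))

theorem S_succ_le (p : ℝ) (t a : ℕ) :
    φ.S p (t + 1) a ≤ φ.S p t a + if a ≤ φ.w t (φ.mv t) then 1 else 0 := by
  unfold S
  have h1 : ∀ h ∈ Finset.Ico a ⌈2 * p * Fintype.card V⌉₊,
      min (φ.c (t + 1) h : ℝ) (Fintype.card V - h / (2 * p)) ≤
        min (φ.c t h : ℝ) (Fintype.card V - h / (2 * p)) +
          if φ.w t (φ.mv t) = h then (1 : ℝ) else 0 := by
    intro h _
    have h2 : (φ.c (t + 1) h : ℝ) ≤ φ.c t h + if φ.w t (φ.mv t) = h then (1 : ℝ) else 0 := by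
      have := φ.c_succ_le t h
      split_ifs at this ⊢ <;> exact_mod_cast this
    have h3 : (0 : ℝ) ≤ if φ.w t (φ.mv t) = h then (1 : ℝ) else 0 := by split_ifs <;> norm_num
    rw [← min_add_add_right]
    exact min_le_min h2 (by linarith)
  refine (Finset.sum_le_sum h1).trans ?_
  rw [Finset.sum_add_distrib, Finset.sum_ite_eq]
  gcongr
  split_ifs with h2 h3
  · exact le_rfl
  · exact absurd (Finset.mem_Ico.1 h2).1 h3
  · norm_num
  · exact le_rfl

/-- A brush on a vertex of load `h` affects only the count at height `h`. Max's moves below `a`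
therefore change nothing, and each move of Min adds at most one. -/
theorem S_le_of_odd {p : ℝ} {t₁ t₂ a : ℕ} (ht : t₁ ≤ t₂)
    (h : ∀ i ∈ Finset.Ico t₁ t₂, Odd i → φ.w i (φ.mv i) < a) :
    φ.S p t₂ a ≤ φ.S p t₁ a + ((Finset.Ico t₁ t₂).filter (¬ Odd ·)).card := by
  induction t₂, ht using Nat.le_induction with
  | base => simp
  | succ t ht ih =>
    have ih' := ih fun i hi => h i (by simp only [Finset.mem_Ico] at hi ⊢; omega)
    have hs := φ.S_succ_le p t a
    rw [← Finset.insert_Ico_right_eq_Ico_add_one ht, Finset.filter_insert]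
    by_cases ho : Odd t
    · have := h t (by simp only [Finset.mem_Ico]; omega) ho
      rw [if_neg (by omega)] at hs
      rw [if_neg (by simpa using ho)]
      linarith
    · rw [if_pos ho, Finset.card_insert_of_notMem (by simp)]
      push_cast
      have : (if a ≤ φ.w t (φ.mv t) then (1 : ℝ) else 0) ≤ 1 := by split_ifs <;> norm_num
      linarith

/-- Until time `τ b` Max only fills gaps below `b`, each pair of level and vertex at most once. Min
has at most one move more, even if he plays only above `b`. -/
theorem S_stage {p : ℝ} {t₁ a b : ℕ} (ht : t₁ ≤ φ.τ b)
    (h : ∀ i, t₁ ≤ i → i < φ.τ b → a ≤ φ.w i (φ.mv i)) :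
    φ.S p (φ.τ b) b ≤ φ.S p t₁ b +
      ∑ k ∈ Finset.Ico a b, ((Finset.univ.filter fun v => φ.w t₁ v ≤ k).card : ℝ) + 1 := by
  have h1 := φ.S_le_of_odd (p := p) ht (a := b) fun i hi ho =>
    φ.w_mv_lt (Finset.mem_Ico.1 hi).2 ho
  have h2 := card_even_Ico_le t₁ (φ.τ b)
  have h3 := φ.card_odd_le (t₁ := t₁) (t₂ := φ.τ b) (a := a) (b := b) fun i hi ho =>
    Finset.mem_Ico.2 ⟨h i (Finset.mem_Ico.1 hi).1 (Finset.mem_Ico.1 hi).2,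
      φ.w_mv_lt (Finset.mem_Ico.1 hi).2 ho⟩
  have h4 : ((Finset.Ico t₁ (φ.τ b)).filter (¬ Odd ·)).card ≤
      ∑ k ∈ Finset.Ico a b, (Finset.univ.filter fun v => φ.w t₁ v ≤ k).card + 1 := by
    have := Nat.mod_lt (φ.τ b) (show 2 > 0 by norm_num)
    omega
  have h5 : (((Finset.Ico t₁ (φ.τ b)).filter (¬ Odd ·)).card : ℝ) ≤
      ∑ k ∈ Finset.Ico a b, ((Finset.univ.filter fun v => φ.w t₁ v ≤ k).card : ℝ) + 1 := by
    exact_mod_cast h4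
  linarith

theorem card_w_le (t k : ℕ) :
    ((Finset.univ.filter fun v => φ.w t v ≤ k).card : ℝ) = Fintype.card V - φ.c t k := by
  have := Finset.card_filter_add_card_filter_not (s := (Finset.univ : Finset V))
    (fun v => k < φ.w t v)
  simp only [not_lt, Finset.card_univ] at this
  rw [← this, c]
  push_cast
  ring

/-- The recursion for the truncated height when the least load grows by one. -/
theorem S_level_succ {p : ℝ} {ℓ : ℕ} (hℓ : ℓ < ⌈2 * p * Fintype.card V⌉₊) :
    φ.S p (φ.τ (ℓ + 1)) (ℓ + 1) ≤ φ.S p (φ.τ ℓ) ℓ + Fintype.card V + 1 -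
      2 * min (φ.c (φ.τ ℓ) ℓ : ℝ) (Fintype.card V - ℓ / (2 * p)) := by
  have h1 := φ.S_stage (p := p) (t₁ := φ.τ ℓ) (a := ℓ) (b := ℓ + 1) (φ.τ_mono (by omega))
    fun i hi hlt => φ.le_w_of_τ_le hi (hlt.le.trans (φ.τ_le _))
      (φ.mv_mem i (hlt.trans_le (φ.τ_le _)))
  rw [Nat.Ico_succ_singleton, Finset.sum_singleton, card_w_le] at h1
  have h2 : φ.S p (φ.τ ℓ) ℓ = min (φ.c (φ.τ ℓ) ℓ : ℝ) (Fintype.card V - ℓ / (2 * p)) +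
      φ.S p (φ.τ ℓ) (ℓ + 1) := by
    unfold S
    rw [Finset.sum_eq_sum_Ico_succ_bot hℓ]
  have h3 := min_le_left (φ.c (φ.τ ℓ) ℓ : ℝ) (Fintype.card V - ℓ / (2 * p))
  linarith

/-- A Riemann sum compared with the area of a trapezoid, by telescoping `ψ`. The function `y` is
taken one level early, `y (h + 1) = min j (n - h / (2 * p))`, so that the drop of `ψ` dominates each
term. -/
theorem sum_min_le {p n j : ℝ} (hp : 0 < p) (hj : 0 ≤ j) {ℓ H : ℕ} (hℓ : ℓ ≤ H)
    (hH : (H : ℝ) ≤ 2 * p * n + 1) (hjℓ : j ≤ n - ℓ / (2 * p)) :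
    ∑ h ∈ Finset.Ico ℓ H, min j (n - h / (2 * p)) ≤ j * (2 * p * n - ℓ + 1) - p * j ^ 2 := by
  set y : ℕ → ℝ := fun h => min j ((2 * p * n - h + 1) / (2 * p)) with hy
  set ψ : ℕ → ℝ := fun h => y h * (2 * p * n - h + 1) - p * y h ^ 2 with hψ
  have hyle : ∀ h, 2 * p * y h ≤ 2 * p * n - h + 1 := by
    intro h
    have : y h ≤ (2 * p * n - h + 1) / (2 * p) := min_le_right _ _
    rw [le_div_iff₀ (by positivity)] at this
    linarith
  have key : ∀ H', ℓ ≤ H' → ∑ h ∈ Finset.Ico ℓ H', min j (n - h / (2 * p)) ≤ ψ ℓ - ψ H' := by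
    intro H' hH'
    induction H', hH' using Nat.le_induction with
    | base => simp
    | succ h hh ih =>
      rw [Finset.sum_Ico_succ_top hh]
      have e : y (h + 1) = min j (n - h / (2 * p)) := by
        rw [hy]; simp only []; congr 1; push_cast; field_simp; ring
      have hle : y (h + 1) ≤ y h := by
        rw [hy]; simp only []
        refine min_le_min le_rfl ?_
        push_cast
        gcongr
        linarith
      have h2 : ψ (h + 1) + y (h + 1) ≤ ψ h := by
        have h3 := hyle h
        have e2 : ψ h - ψ (h + 1) - y (h + 1) =
            (y h - y (h + 1)) * (2 * p * n - h + 1 - p * (y h + y (h + 1))) := by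
          rw [hψ]; simp only []; push_cast; ring
        have h4 : 0 ≤ 2 * p * n - h + 1 - p * (y h + y (h + 1)) := by
          have := mul_le_mul_of_nonneg_left hle hp.le
          linarith
        have := mul_nonneg (sub_nonneg.2 hle) h4
        linarith
      rw [← e]
      linarith
  refine (key H hℓ).trans ?_
  have hyℓ : y ℓ = j := by
    refine min_eq_left (hjℓ.trans ?_)
    rw [le_div_iff₀ (by positivity), sub_mul, div_mul_cancel₀ _ (by positivity)]
    linarith
  have hyH : 0 ≤ y H := le_min hj (div_nonneg (by linarith) (by positivity))
  have hψH : 0 ≤ ψ H := by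
    have h1 := hyle H
    have e2 : ψ H = y H * (2 * p * n - H + 1 - p * y H) := by rw [hψ]; ring
    rw [e2]
    refine mul_nonneg hyH ?_
    have : 0 ≤ p * y H := by positivity
    linarith
  have e3 : ψ ℓ = j * (2 * p * n - ℓ + 1) - p * j ^ 2 := by rw [hψ]; simp only [hyℓ]
  linarith

theorem lt_of_lt_ceil {p : ℝ} {ℓ : ℕ} (hℓ : ℓ < ⌈2 * p * Fintype.card V⌉₊) :
    (ℓ : ℝ) < 2 * p * Fintype.card V := Nat.lt_ceil.1 hℓ

/-- The capacity bound for the truncated height. -/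
theorem S_le_capacity {p : ℝ} (hp : 0 < p) {t ℓ : ℕ} (hℓ : ℓ < ⌈2 * p * Fintype.card V⌉₊) {j : ℝ}
    (hj : j = min (φ.c t ℓ : ℝ) (Fintype.card V - ℓ / (2 * p))) :
    φ.S p t ℓ ≤ j * (2 * p * Fintype.card V - ℓ) - p * j ^ 2 + Fintype.card V := by
  have hlt := lt_of_lt_ceil hℓ
  have hg : (0 : ℝ) ≤ Fintype.card V - ℓ / (2 * p) := by
    rw [sub_nonneg, div_le_iff₀ (by positivity)]; linarith
  have hj0 : 0 ≤ j := by rw [hj]; exact le_min (by positivity) hg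
  have hjn : j ≤ Fintype.card V := by
    rw [hj]; exact (min_le_left _ _).trans (by exact_mod_cast φ.c_le_card t ℓ)
  have h1 : φ.S p t ℓ ≤ ∑ h ∈ Finset.Ico ℓ ⌈2 * p * Fintype.card V⌉₊,
      min j (Fintype.card V - h / (2 * p)) := by
    refine Finset.sum_le_sum fun h hh => le_min ?_ (min_le_right _ _)
    have hle := (Finset.mem_Ico.1 hh).1
    rw [hj]
    refine min_le_min (by exact_mod_cast φ.c_anti t hle) ?_
    have : (ℓ : ℝ) ≤ h := by exact_mod_cast hle
    gcongr
  have h2 := sum_min_le (n := Fintype.card V) hp hj0 hℓ.le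
    (Nat.ceil_lt_add_one (by positivity)).le (hj ▸ min_le_right _ _)
  linarith

/-- The truncated height when all loads have reached the average degree. -/
theorem S_start {p Δ : ℝ} (hG : CutBound G p Δ) (hp : 0 < p) :
    φ.S p (φ.τ ⌈p * Fintype.card V⌉₊) ⌈p * Fintype.card V⌉₊ ≤
      4 * Δ + Fintype.card V + 1 := by
  set a := ⌈p * Fintype.card V⌉₊ with ha
  have hpn : 0 ≤ p * Fintype.card V := by positivity
  have ha1 : p * Fintype.card V ≤ a := Nat.le_ceil _
  have ha2 : (a : ℝ) ≤ p * Fintype.card V + 1 := (Nat.ceil_lt_add_one hpn).le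
  have h1 := φ.S_stage (p := p) (t₁ := 0) (a := 0) (b := a) (by omega) (by simp)
  have hdev := hG.sum_abs_le Finset.univ Finset.univ
  rw [Finset.card_univ] at hdev
  have hw0 : ∀ v, φ.w 0 v = nbrs G Finset.univ v := by simp [w]
  have h2 : ∑ k ∈ Finset.Ico 0 a, ((Finset.univ.filter fun v => φ.w 0 v ≤ k).card : ℝ) ≤
      2 * Δ + Fintype.card V := by
    have e : ∑ k ∈ Finset.Ico 0 a, ((Finset.univ.filter fun v => φ.w 0 v ≤ k).card : ℝ) =
        ∑ v, (((Finset.Ico 0 a).filter fun k => φ.w 0 v ≤ k).card : ℝ) := by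
      exact_mod_cast Finset.sum_card_bipartiteAbove_eq_sum_card_bipartiteBelow
        (s := Finset.Ico 0 a) (t := (Finset.univ : Finset V)) (fun k v => φ.w 0 v ≤ k)
    rw [e]
    calc _ ≤ ∑ v : V, (|(nbrs G Finset.univ v : ℝ) - p * Fintype.card V| + 1) := by
          refine Finset.sum_le_sum fun v _ => ?_
          have : (Finset.Ico 0 a).filter (fun k => φ.w 0 v ≤ k) = Finset.Ico (φ.w 0 v) a := by
            ext k; simp [and_comm]
          rw [this, Nat.card_Ico, hw0]
          have h3 := neg_abs_le ((nbrs G Finset.univ v : ℝ) - p * Fintype.card V)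
          have h4 := abs_nonneg ((nbrs G Finset.univ v : ℝ) - p * Fintype.card V)
          rcases le_total (nbrs G Finset.univ v) a with h | h
          · rw [Nat.cast_sub h]; linarith
          · rw [Nat.sub_eq_zero_of_le h]; push_cast; linarith
      _ ≤ _ := by
          rw [Finset.sum_add_distrib, Finset.sum_const, Finset.card_univ, nsmul_eq_mul, mul_one]
          linarith
  have h3 : φ.S p 0 a ≤ 2 * Δ := by
    have e : ∑ k ∈ Finset.Ico a ⌈2 * p * Fintype.card V⌉₊, (φ.c 0 k : ℝ) =
        ∑ v, (((Finset.Ico a ⌈2 * p * Fintype.card V⌉₊).filter fun k => k < φ.w 0 v).card : ℝ) := by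
      exact_mod_cast Finset.sum_card_bipartiteAbove_eq_sum_card_bipartiteBelow
        (s := Finset.Ico a ⌈2 * p * Fintype.card V⌉₊) (t := (Finset.univ : Finset V))
        (fun k v => k < φ.w 0 v)
    calc φ.S p 0 a ≤ ∑ k ∈ Finset.Ico a ⌈2 * p * Fintype.card V⌉₊, (φ.c 0 k : ℝ) :=
          Finset.sum_le_sum fun k _ => min_le_left _ _
      _ = _ := e
      _ ≤ ∑ v : V, |(nbrs G Finset.univ v : ℝ) - p * Fintype.card V| := by
          refine Finset.sum_le_sum fun v _ => ?_
          have : ((Finset.Ico a ⌈2 * p * Fintype.card V⌉₊).filter fun k => k < φ.w 0 v).card ≤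
              (Finset.Ico a (φ.w 0 v)).card := by
            refine Finset.card_le_card fun k hk => ?_
            simp only [Finset.mem_filter, Finset.mem_Ico] at hk ⊢
            exact ⟨hk.1.1, hk.2⟩
          refine (Nat.cast_le.2 this).trans ?_
          rw [Nat.card_Ico, hw0]
          have h3 := le_abs_self ((nbrs G Finset.univ v : ℝ) - p * Fintype.card V)
          have h4 := abs_nonneg ((nbrs G Finset.univ v : ℝ) - p * Fintype.card V)
          rcases le_total a (nbrs G Finset.univ v) with h | h
          · rw [Nat.cast_sub h]; linarith
          · rw [Nat.sub_eq_zero_of_le h]; push_cast; linarith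
      _ ≤ _ := hdev
  linarith

end MaxPlay

end PlayFacts

end Brushing

namespace Brushing

/-! ### The limiting curve for the least load and the height -/

section Curve

open Real Set

/-- The least load, relative to the average degree, at the time when a fraction `κ` of the vertices
is dirty in the limiting game. -/
noncomputable def levelCurve (κ : ℝ) : ℝ := κ * (1 - 2 * log κ)

/-- The truncated height in the limiting game. -/
noncomputable def heightCurve (κ : ℝ) : ℝ := (1 - κ) * (1 + κ - levelCurve κ)

theorem hasDerivAt_levelCurve {κ : ℝ} (h : 0 < κ) :
    HasDerivAt levelCurve (-1 - 2 * log κ) κ := by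
  have h1 : HasDerivAt (fun x : ℝ => 1 - 2 * log x) (-(2 * κ⁻¹)) κ :=
    ((hasDerivAt_log h.ne').const_mul 2).const_sub 1
  refine ((hasDerivAt_id κ).mul h1).congr_deriv ?_
  simp only [id]
  field_simp
  ring

theorem levelCurve_one : levelCurve 1 = 1 := by simp [levelCurve]

theorem neg_half_lt_log {κ : ℝ} (h : exp (-(1 / 2)) < κ) : -(1 / 2) < log κ :=
  (lt_log_iff_exp_lt ((exp_pos _).trans h)).2 h

theorem half_lt_of_exp_lt {κ : ℝ} (h : exp (-(1 / 2)) < κ) : 1 / 2 < κ := by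
  have := add_one_le_exp (-(1 / 2) : ℝ)
  linarith

theorem continuousOn_levelCurve {a : ℝ} (ha : 0 < a) : ContinuousOn levelCurve (Icc a 1) :=
  fun _ hx => (hasDerivAt_levelCurve (ha.trans_le hx.1)).continuousAt.continuousWithinAt

theorem levelCurve_strictAntiOn {a : ℝ} (ha : exp (-(1 / 2)) < a) :
    StrictAntiOn levelCurve (Icc a 1) := by
  have ha0 := (exp_pos _).trans ha
  refine strictAntiOn_of_deriv_neg (convex_Icc a 1) (continuousOn_levelCurve ha0) fun x hx => ?_
  rw [interior_Icc] at hx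
  rw [(hasDerivAt_levelCurve (ha0.trans hx.1)).deriv]
  linarith [neg_half_lt_log (ha.trans hx.1)]

theorem levelCurve_lt {κ : ℝ} (h : exp (-(1 / 2)) < κ) : levelCurve κ < 2 * κ := by
  have h1 := neg_half_lt_log h
  have h0 := (exp_pos _).trans h
  unfold levelCurve
  nlinarith

theorem heightCurve_nonneg {κ : ℝ} (h : 1 / 2 ≤ κ) (h1 : κ ≤ 1) : 0 ≤ heightCurve κ := by
  have h0 : 0 < κ := by linarith
  have h2 := one_sub_inv_le_log_of_pos h0
  have h3 := mul_le_mul_of_nonneg_left h2 h0.le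
  have e : κ * (1 - κ⁻¹) = κ - 1 := by field_simp
  unfold heightCurve levelCurve
  refine mul_nonneg (by linarith) ?_
  linarith

/-- Along the curve the derivative of the height is `2 κ - 1` times that of the level, which is the
limit of the recursion `S_level_succ` with `1 - κ` for the proportion of high vertices. Since the
level decreases in `κ`, the smallest factor `2 κ' - 1` gives a lower bound. -/
theorem heightCurve_sub_ge {κ κ' : ℝ} (h : exp (-(1 / 2)) < κ') (hκ : κ' ≤ κ) (h1 : κ ≤ 1) :
    (levelCurve κ' - levelCurve κ) * (2 * κ' - 1) ≤ heightCurve κ' - heightCurve κ := by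
  have h0 := (exp_pos _).trans h
  have hd : ∀ x, 0 < x → HasDerivAt (fun x => heightCurve x - levelCurve x * (2 * κ' - 1))
      ((-1 - 2 * log x) * (2 * (x - κ'))) x := by
    intro x hx
    have d1 := hasDerivAt_levelCurve hx
    have d2 : HasDerivAt (fun x : ℝ => 1 - x) (-1) x := (hasDerivAt_id x).const_sub 1
    have d3 : HasDerivAt (fun x : ℝ => 1 + x - levelCurve x) (1 - (-1 - 2 * log x)) x :=
      ((hasDerivAt_id x).const_add 1).sub d1
    refine ((d2.mul d3).sub (d1.mul_const (2 * κ' - 1))).congr_deriv ?_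
    simp only [levelCurve]
    ring
  have hanti : AntitoneOn (fun x => heightCurve x - levelCurve x * (2 * κ' - 1)) (Icc κ' 1) := by
    refine antitoneOn_of_deriv_nonpos (convex_Icc κ' 1)
      (fun x hx => (hd x (h0.trans_le hx.1)).continuousAt.continuousWithinAt)
      (fun x hx => ?_) fun x hx => ?_
    · rw [interior_Icc] at hx
      exact (hd x (h0.trans hx.1)).differentiableAt.differentiableWithinAt
    · rw [interior_Icc] at hx
      rw [(hd x (h0.trans hx.1)).deriv]
      have := neg_half_lt_log (h.trans hx.1)
      refine mul_nonpos_of_nonpos_of_nonneg (by linarith) ?_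
      linarith [hx.1]
  have := hanti (left_mem_Icc.2 (hκ.trans h1)) ⟨hκ, h1⟩ hκ
  simp only [] at this
  linarith

/-- The height needed for cleaning, minus the height available, is a square. It vanishes only when
the least load `λ` meets the threshold `2 κ`. -/
theorem sq_sub_heightCurve (κ : ℝ) :
    (1 - levelCurve κ / 2) ^ 2 - heightCurve κ = (κ - levelCurve κ / 2) ^ 2 := by
  unfold heightCurve; ring

theorem exists_levelCurve_eq {a l : ℝ} (ha : exp (-(1 / 2)) < a) (ha1 : a ≤ 1) (hl : 1 ≤ l)
    (hl' : l ≤ levelCurve a) : ∃ κ, a ≤ κ ∧ κ ≤ 1 ∧ levelCurve κ = l := by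
  have := intermediate_value_Icc' ha1 (continuousOn_levelCurve ((exp_pos _).trans ha))
  obtain ⟨κ, hκ, he⟩ := this ⟨by rwa [levelCurve_one], hl'⟩
  exact ⟨κ, hκ.1, hκ.2, he⟩

end Curve

/-! ### The lower bound: Max's least-load strategy -/

section Lower

variable {V : Type*} [Fintype V] [DecidableEq V] {G : SimpleGraph V} (φ : MaxPlay G)

namespace MaxPlay

/-- Along the play the truncated height stays below that of the limiting game. -/
theorem S_le_heightCurve {p Δ κ₁ : ℝ} (hG : CutBound G p Δ) (hp : 0 < p) [Nonempty V]
    (hκ₁ : Real.exp (-(1 / 2)) < κ₁) (hκ₁' : κ₁ ≤ 1) {ℓ : ℕ}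
    (hℓ : ⌈p * Fintype.card V⌉₊ ≤ ℓ) (hℓ' : ℓ ≤ levelCurve κ₁ * (p * Fintype.card V)) :
    ∃ κ, κ₁ ≤ κ ∧ κ ≤ 1 ∧ levelCurve κ * (p * Fintype.card V) = ℓ ∧
      φ.S p (φ.τ ℓ) ℓ ≤ p * (Fintype.card V : ℝ) ^ 2 * heightCurve κ + 4 * Δ +
        2 * Fintype.card V + 1 + (ℓ - ⌈p * Fintype.card V⌉₊) + 2 * Fintype.card V * (1 - κ) := by
  set n : ℝ := (Fintype.card V : ℝ) with hn
  set a := ⌈p * n⌉₊ with ha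
  have hn0 : 0 < n := by rw [hn]; exact_mod_cast Fintype.card_pos
  have hpn : 0 < p * n := by positivity
  have ha1 : p * n ≤ a := Nat.le_ceil _
  have hΔ := hG.nonneg
  have hex : ∀ ℓ : ℕ, a ≤ ℓ → ℓ ≤ levelCurve κ₁ * (p * n) →
      ∃ κ, κ₁ ≤ κ ∧ κ ≤ 1 ∧ levelCurve κ * (p * n) = ℓ := by
    intro ℓ h1 h2
    have h3 : (a : ℝ) ≤ ℓ := by exact_mod_cast h1
    obtain ⟨κ, hκ, hκ1, he⟩ := exists_levelCurve_eq hκ₁ hκ₁' (l := ℓ / (p * n))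
      (by rw [le_div_iff₀ hpn]; linarith) (by rw [div_le_iff₀ hpn]; exact h2)
    exact ⟨κ, hκ, hκ1, by rw [he, div_mul_cancel₀ _ hpn.ne']⟩
  induction ℓ, hℓ using Nat.le_induction with
  | base =>
    obtain ⟨κ, h1, h2, h3⟩ := hex a le_rfl hℓ'
    refine ⟨κ, h1, h2, h3, (φ.S_start hG hp).trans ?_⟩
    have h4 := heightCurve_nonneg ((half_lt_of_exp_lt hκ₁).le.trans h1) h2
    have h5 : 0 ≤ p * n ^ 2 * heightCurve κ := by positivity
    have h6 : 0 ≤ 2 * n * (1 - κ) := mul_nonneg (by positivity) (by linarith)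
    rw [sub_self]
    linarith
  | succ ℓ hℓ ih =>
    have hℓ1 : (ℓ : ℝ) ≤ levelCurve κ₁ * (p * n) := by push_cast at hℓ'; linarith
    obtain ⟨κ, h1, h2, h3, h4⟩ := ih hℓ1
    obtain ⟨κ', g1, g2, g3⟩ := hex (ℓ + 1) (by omega) hℓ'
    refine ⟨κ', g1, g2, g3, ?_⟩
    have hκ' : κ' ≤ κ := by
      by_contra hlt
      push Not at hlt
      have := levelCurve_strictAntiOn hκ₁ ⟨h1, h2⟩ ⟨g1, g2⟩ hlt
      have := mul_lt_mul_of_pos_right this hpn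
      rw [h3, g3] at this
      push_cast at this
      linarith
    have hinc := heightCurve_sub_ge (hκ₁.trans_le g1) hκ' h2
    have hinc' : n * (2 * κ' - 1) ≤ p * n ^ 2 * heightCurve κ' - p * n ^ 2 * heightCurve κ := by
      have e1 : p * n * (levelCurve κ' - levelCurve κ) = 1 := by
        push_cast at g3
        linarith
      calc n * (2 * κ' - 1) = p * n ^ 2 * ((levelCurve κ' - levelCurve κ) * (2 * κ' - 1)) := by
            linear_combination -(n * (2 * κ' - 1)) * e1
        _ ≤ p * n ^ 2 * (heightCurve κ' - heightCurve κ) := by gcongr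
        _ = _ := by ring
    have hlt := levelCurve_lt (hκ₁.trans_le h1)
    have hlt2 : (ℓ : ℝ) < 2 * κ * (p * n) := by rw [← h3]; gcongr
    have hceil : ℓ < ⌈2 * p * n⌉₊ := by
      rw [Nat.lt_ceil]
      have : 2 * κ * (p * n) ≤ 2 * 1 * (p * n) := by gcongr
      linarith
    have hrec := φ.S_level_succ (p := p) hceil
    have hcap := φ.S_le_capacity hp (t := φ.τ ℓ) hceil rfl
    set j := min (φ.c (φ.τ ℓ) ℓ : ℝ) (Fintype.card V - ℓ / (2 * p)) with hj
    rw [← hn] at hrec hcap hj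
    have hj0 : 0 ≤ j := by
      refine le_min (by positivity) ?_
      rw [sub_nonneg, div_le_iff₀ (by positivity)]
      have := Nat.lt_ceil.1 hceil
      linarith
    have hsucc : ((ℓ + 1 : ℕ) : ℝ) = ℓ + 1 := by push_cast; ring
    rw [hsucc]
    -- Below the curve plus `n`, the slack `2 n` pays for one level, which adds at most `n + 1`.
    -- Otherwise the capacity bound forces `j ≥ n (1 - κ)`, and the level adds at most `n (2 κ - 1)
    -- + 1`. The excess `2 n (κ - κ')` over the growth of the curve goes into the term `2 n (1 -
    -- κ')`.
    by_cases hcase : φ.S p (φ.τ ℓ) ℓ < n + p * n ^ 2 * heightCurve κ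
    · have : (a : ℝ) ≤ ℓ := by exact_mod_cast hℓ
      nlinarith
    · push Not at hcase
      have hjκ : n * (1 - κ) ≤ j := by
        by_contra hlt3
        push Not at hlt3
        have e2 : p * n ^ 2 * heightCurve κ =
            n * (1 - κ) * (2 * p * n - ℓ) - p * (n * (1 - κ)) ^ 2 := by
          rw [← h3]; unfold heightCurve; ring
        have h5 : 0 < (n * (1 - κ) - j) * (2 * p * n - ℓ - p * (n * (1 - κ) + j)) := by
          refine mul_pos (by linarith) ?_
          have := mul_lt_mul_of_pos_left hlt3 hp
          linarith
        nlinarith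
      nlinarith

/-- At every time the clean vertices form an initial segment of the firing order, so counting them
decides which positions are clean. The next lemma is the converse side. -/
theorem mem_clean_of_pos_lt {t : ℕ} (ht : t ≤ φ.T) {v : V}
    (h : pos φ.rank v + (φ.dirty t).card < Fintype.card V) : v ∉ φ.dirty t := by
  intro hv
  have h1 : (φ.dirty t)ᶜ ⊆ Finset.univ.filter fun u => φ.rank u < φ.rank v := by
    intro u hu
    simpa using φ.rank_lt t ht u (by simpa using hu) v hv
  have h2 := Finset.card_le_card h1
  rw [Finset.card_compl] at h2
  unfold pos at h
  omega

theorem mem_dirty_of_le_pos {t : ℕ} (ht : t ≤ φ.T) {v : V}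
    (h : Fintype.card V ≤ pos φ.rank v + (φ.dirty t).card) : v ∈ φ.dirty t := by
  by_contra hv
  have h1 : Finset.univ.filter (fun u => φ.rank u < φ.rank v) ⊆ ((φ.dirty t)ᶜ).erase v := by
    intro u hu
    simp only [Finset.mem_filter, Finset.mem_univ, true_and] at hu
    refine Finset.mem_erase.2 ⟨by rintro rfl; omega, ?_⟩
    rw [Finset.mem_compl]
    intro hud
    have := φ.rank_lt t ht v hv u hud
    omega
  have h2 := Finset.card_le_card h1
  have h3 := Finset.card_erase_add_one (show v ∈ (φ.dirty t)ᶜ by simpa using hv)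
  rw [Finset.card_compl] at h3
  unfold pos at h
  omega

/-- The number of neighbours of `v` that fire later. -/
noncomputable def later (v : V) : ℕ :=
  nbrs G (Finset.univ.filter fun u => φ.rank v < φ.rank u) v

theorem two_mul_later_le (v : V) : 2 * φ.later v ≤ φ.w φ.T v := by
  classical
  refine φ.fire_le v _ fun u hu => ?_
  simp only [Finset.mem_filter, Finset.mem_univ, true_and] at hu
  exact ⟨hu.2, hu.1⟩

theorem sum_first_ge {p : ℝ} (hp : 0 ≤ p) {j : ℕ} (hj : j ≤ Fintype.card V) :
    2 * p * Fintype.card V * j - p * (j : ℝ) ^ 2 ≤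
      ∑ v ∈ Finset.univ.filter (fun v => pos φ.rank v < j),
        2 * p * ((Fintype.card V : ℝ) - pos φ.rank v) := by
  rw [sum_pos φ.rank_inj (· < j) (fun i => 2 * p * ((Fintype.card V : ℝ) - i))]
  have e : (Finset.range (Fintype.card V)).filter (· < j) = Finset.range j := by
    ext i; simp; omega
  rw [e]
  clear hj e
  induction j with
  | zero => simp
  | succ j ih =>
    rw [Finset.sum_range_succ]
    push_cast
    nlinarith

theorem card_first {j : ℕ} (hj : j ≤ Fintype.card V) :
    (Finset.univ.filter (fun v => pos φ.rank v < j)).card = j := by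
  rw [card_pos φ.rank_inj (· < j)]
  have e : (Finset.range (Fintype.card V)).filter (· < j) = Finset.range j := by
    ext i; simp; omega
  rw [e, Finset.card_range]

/-- If `j` vertices are clean, then the truncated height is large. -/
theorem le_S_of_clean {p : ℝ} (hp : 0 < p) {t ℓ j : ℕ} (ht : t ≤ φ.T)
    (hj : j + (φ.dirty t).card ≤ Fintype.card V) :
    2 * p * Fintype.card V * j - p * (j : ℝ) ^ 2 - ℓ * j - 2 * p * j -
      2 * ∑ v, |(φ.later v : ℝ) - p * ((Fintype.card V : ℝ) - pos φ.rank v)| ≤ φ.S p t ℓ := by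
  classical
  set n : ℝ := (Fintype.card V : ℝ) with hn
  set A := Finset.univ.filter (fun v => pos φ.rank v < j) with hA
  -- The `- 1` ensures that position `i` is counted at height `h` only if `i + 1 ≤ n - h / (2 * p)`.
  -- The number of such positions is then at most the truncation in `S`.
  set y : V → ℝ := fun v => min (2 * φ.later v : ℝ) (2 * p * (n - pos φ.rank v - 1)) with hy
  set H := ⌈2 * p * n⌉₊ with hH
  have hAw : ∀ v ∈ A, 2 * φ.later v ≤ φ.w t v := by
    intro v hv
    have hv' := (Finset.mem_filter.1 hv).2
    rw [← φ.w_eq_of_notMem ht (φ.mem_clean_of_pos_lt ht (by omega))]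
    exact φ.two_mul_later_le v
  have h1 : ∀ h ∈ Finset.Ico ℓ H, ((A.filter fun v => (h : ℝ) < y v).card : ℝ) ≤
      min (φ.c t h : ℝ) (n - h / (2 * p)) := by
    intro h hh
    refine le_min ?_ ?_
    · refine Nat.cast_le.2 (Finset.card_le_card fun v hv => ?_)
      obtain ⟨hvA, hvy⟩ := Finset.mem_filter.1 hv
      have h2 : (h : ℝ) < 2 * φ.later v := hvy.trans_le (min_le_left _ _)
      have h3 : h < 2 * φ.later v := by exact_mod_cast h2
      simpa using h3.trans_le (hAw v hvA)
    · have hlt : (h : ℝ) < 2 * p * n := Nat.lt_ceil.1 (Finset.mem_Ico.1 hh).2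
      have hg : 0 ≤ n - h / (2 * p) := by
        rw [sub_nonneg, div_le_iff₀ (by positivity)]; linarith
      refine le_trans ?_ (Nat.floor_le hg)
      refine Nat.cast_le.2 ?_
      rw [← Finset.card_image_of_injective _ (pos_injective φ.rank_inj)]
      calc _ ≤ (Finset.range ⌊n - h / (2 * p)⌋₊).card := by
            refine Finset.card_le_card fun i hi => ?_
            obtain ⟨v, hv, rfl⟩ := Finset.mem_image.1 hi
            have h2 : (h : ℝ) < 2 * p * (n - pos φ.rank v - 1) :=
              (Finset.mem_filter.1 hv).2.trans_le (min_le_right _ _)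
            rw [Finset.mem_range, ← Nat.succ_le_iff, Nat.le_floor_iff hg]
            push_cast
            rw [le_sub_iff_add_le, ← le_sub_iff_add_le', div_le_iff₀ (by positivity)]
            linarith
        _ = _ := Finset.card_range _
  have e : ∑ h ∈ Finset.Ico ℓ H, ((A.filter fun v => (h : ℝ) < y v).card : ℝ) =
      ∑ v ∈ A, (((Finset.Ico ℓ H).filter fun h : ℕ => (h : ℝ) < y v).card : ℝ) := by
    exact_mod_cast Finset.sum_card_bipartiteAbove_eq_sum_card_bipartiteBelow
      (s := Finset.Ico ℓ H) (t := A) (fun (h : ℕ) v => (h : ℝ) < y v)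
  have h2 : ∀ v ∈ A, y v - ℓ ≤ (((Finset.Ico ℓ H).filter fun h : ℕ => (h : ℝ) < y v).card : ℝ) := by
    intro v _
    have hyn : y v ≤ 2 * p * n := by
      refine (min_le_right _ _).trans ?_
      have : (0 : ℝ) ≤ pos φ.rank v := by positivity
      nlinarith
    have h3 : Finset.Ico ℓ ⌈y v⌉₊ ⊆ (Finset.Ico ℓ H).filter fun h : ℕ => (h : ℝ) < y v := by
      intro h hh
      obtain ⟨h4, h5⟩ := Finset.mem_Ico.1 hh
      exact Finset.mem_filter.2 ⟨Finset.mem_Ico.2 ⟨h4, h5.trans_le (Nat.ceil_le_ceil hyn)⟩,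
        Nat.lt_ceil.1 h5⟩
    refine le_trans ?_ (Nat.cast_le.2 (Finset.card_le_card h3))
    rw [Nat.card_Ico]
    have h6 : (⌈y v⌉₊ : ℝ) ≤ ((⌈y v⌉₊ - ℓ : ℕ) : ℝ) + ℓ := by
      exact_mod_cast (by omega : ⌈y v⌉₊ ≤ (⌈y v⌉₊ - ℓ) + ℓ)
    linarith [Nat.le_ceil (y v)]
  have h3 : ∀ v ∈ A, 2 * p * (n - pos φ.rank v) -
      (2 * p + ℓ + 2 * |(φ.later v : ℝ) - p * (n - pos φ.rank v)|) ≤ y v - ℓ := by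
    intro v _
    have h4 := neg_abs_le ((φ.later v : ℝ) - p * (n - pos φ.rank v))
    have h5 := abs_nonneg ((φ.later v : ℝ) - p * (n - pos φ.rank v))
    have : 2 * p * (n - pos φ.rank v) - 2 * p -
        2 * |(φ.later v : ℝ) - p * (n - pos φ.rank v)| ≤ y v := by
      refine le_min ?_ ?_ <;> nlinarith
    linarith
  have h4 : ∑ v ∈ A, |(φ.later v : ℝ) - p * (n - pos φ.rank v)| ≤
      ∑ v, |(φ.later v : ℝ) - p * (n - pos φ.rank v)| :=
    Finset.sum_le_sum_of_subset_of_nonneg (Finset.subset_univ _) fun _ _ _ => abs_nonneg _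
  have h5 := φ.sum_first_ge hp.le (show j ≤ Fintype.card V by omega)
  have h6 := Finset.sum_le_sum h3
  rw [Finset.sum_sub_distrib, Finset.sum_add_distrib, Finset.sum_const, hA,
    φ.card_first (show j ≤ Fintype.card V by omega), nsmul_eq_mul, ← hA] at h6
  rw [← hA, ← hn] at h5
  simp only [← Finset.mul_sum] at h5 h6
  have h7 := Finset.sum_le_sum h2
  have h8 := Finset.sum_le_sum h1
  rw [e] at h8
  have h9 : φ.S p t ℓ = ∑ h ∈ Finset.Ico ℓ H, min (φ.c t h : ℝ) (n - h / (2 * p)) := rfl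
  linarith

/-- If few vertices are clean when all loads are at least `ℓ`, then the play is long. -/
theorem le_T_of_dirty {p Δ : ℝ} (hG : CutBound G p Δ) (hp : 0 < p) {ℓ j : ℕ}
    (hjn : j ≤ Fintype.card V)
    (hj : Fintype.card V ≤ j + (φ.dirty (φ.τ ℓ)).card) :
    2 * p * Fintype.card V * j - p * (j : ℝ) ^ 2 - ℓ * j + ℓ * Fintype.card V -
      p * (Fintype.card V : ℝ) ^ 2 - Δ -
      2 * ∑ v, |(φ.later v : ℝ) - p * ((Fintype.card V : ℝ) - pos φ.rank v)| ≤ φ.T := by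
  classical
  set n : ℝ := (Fintype.card V : ℝ) with hn
  set A := Finset.univ.filter (fun v => pos φ.rank v < j) with hA
  have h1 : ∑ v, (φ.w φ.T v : ℝ) = ∑ v, (nbrs G Finset.univ v : ℝ) + φ.T := by
    exact_mod_cast φ.sum_w φ.T
  have h2 := (abs_le.1 (hG Finset.univ Finset.univ)).2
  rw [Finset.card_univ, ← hn] at h2
  have h3 : ∑ v ∈ A, (2 * p * (n - pos φ.rank v) -
      2 * |(φ.later v : ℝ) - p * (n - pos φ.rank v)|) ≤ ∑ v ∈ A, (φ.w φ.T v : ℝ) := by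
    refine Finset.sum_le_sum fun v _ => ?_
    have h4 : (2 * φ.later v : ℝ) ≤ φ.w φ.T v := by exact_mod_cast φ.two_mul_later_le v
    have h5 := neg_abs_le ((φ.later v : ℝ) - p * (n - pos φ.rank v))
    linarith
  have h4 : ∑ v ∈ A, |(φ.later v : ℝ) - p * (n - pos φ.rank v)| ≤
      ∑ v, |(φ.later v : ℝ) - p * (n - pos φ.rank v)| :=
    Finset.sum_le_sum_of_subset_of_nonneg (Finset.subset_univ _) fun _ _ _ => abs_nonneg _
  have h5 := φ.sum_first_ge hp.le hjn
  rw [Finset.sum_sub_distrib, ← Finset.mul_sum (f := fun v =>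
    |(φ.later v : ℝ) - p * (n - pos φ.rank v)|)] at h3
  have h6 : (Aᶜ.card : ℝ) * ℓ ≤ ∑ v ∈ Aᶜ, (φ.w φ.T v : ℝ) := by
    rw [← nsmul_eq_mul]
    refine Finset.card_nsmul_le_sum _ _ _ fun v hv => ?_
    have hv' : j ≤ pos φ.rank v := by simpa [hA] using hv
    have hd := φ.mem_dirty_of_le_pos (φ.τ_le ℓ) (v := v) (by omega)
    exact_mod_cast (φ.le_w_of_τ_le le_rfl (φ.τ_le ℓ) hd).trans (φ.w_mono (φ.τ_le ℓ) v)
  rw [Finset.card_compl, hA, φ.card_first hjn, Nat.cast_sub hjn, ← hn, ← hA] at h6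
  have h7 := Finset.sum_add_sum_compl A fun v => (φ.w φ.T v : ℝ)
  linarith

end MaxPlay

/-- The lower bound for the game brush number, with explicit error terms. -/
theorem le_gameBrushNumber {p Δ κ : ℝ} [Nonempty V] (hG : CutBound G p Δ) (hp : 0 < p)
    {m M : ℕ} (hm : 0 < m) (hmM : Fintype.card V ≤ M * m)
    (hκ : Real.exp (-(1 / 2)) < κ) (hκ1 : κ ≤ 1)
    (hlarge : p * Fintype.card V + 2 ≤ levelCurve κ * (p * Fintype.card V))
    (herr : 4 * Δ + 4 * Fintype.card V + 4 * p * Fintype.card V + p + 1 +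
      2 * (M * (3 * Δ + 2 * p * m ^ 2)) <
        p * (Fintype.card V : ℝ) ^ 2 * (κ - levelCurve κ / 2) ^ 2) :
    (levelCurve κ * (p * Fintype.card V) - 1) ^ 2 / (4 * p) - p - Δ -
      2 * (M * (3 * Δ + 2 * p * m ^ 2)) ≤ gameBrushNumber G := by
  obtain ⟨φ, hφ⟩ := exists_maxPlay G
  have hφ' : (φ.T : ℝ) ≤ gameBrushNumber G := by exact_mod_cast hφ
  refine le_trans ?_ hφ'
  set n : ℝ := (Fintype.card V : ℝ) with hn
  have hn0 : 0 < n := by rw [hn]; exact_mod_cast Fintype.card_pos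
  have hpn : 0 < p * n := by positivity
  have horder := hG.sum_abs_later_le hp.le φ.rank_inj hm hmM
  rw [← hn] at horder
  change ∑ v, |(φ.later v : ℝ) - p * (n - pos φ.rank v)| ≤ _ at horder
  set Err := (M : ℝ) * (3 * Δ + 2 * p * m ^ 2)
  have hlam0 : 0 ≤ levelCurve κ * (p * n) := by linarith
  set ℓ := ⌊levelCurve κ * (p * n)⌋₊ with hℓ
  have hℓ1 : (ℓ : ℝ) ≤ levelCurve κ * (p * n) := Nat.floor_le hlam0
  have hℓ2 : levelCurve κ * (p * n) < ℓ + 1 := Nat.lt_floor_add_one _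
  have hceil : ⌈p * n⌉₊ ≤ ℓ := by
    rw [Nat.ceil_le]; linarith
  have hlt := levelCurve_lt hκ
  have hℓ2n : (ℓ : ℝ) ≤ 2 * (p * n) := by
    refine hℓ1.trans ?_
    gcongr
    linarith
  -- After `x` firings the threshold `2 p (n - x)` has fallen to `ℓ`. This `x` maximizes `2 p n x -
  -- p x ^ 2 - ℓ x`, so rounding it to `j` costs only `p`.
  set x : ℝ := n - ℓ / (2 * p) with hx
  have hx0 : 0 ≤ x := by rw [hx, sub_nonneg, div_le_iff₀ (by positivity)]; linarith
  set j := ⌊x⌋₊ with hj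
  have hj1 : (j : ℝ) ≤ x := Nat.floor_le hx0
  have hj2 : x < j + 1 := Nat.lt_floor_add_one _
  have hxn : x ≤ n := by
    have : 0 ≤ (ℓ : ℝ) / (2 * p) := by positivity
    rw [hx]; linarith
  have hjn : j ≤ Fintype.card V := by
    have : (j : ℝ) ≤ Fintype.card V := hj1.trans hxn
    exact_mod_cast this
  have hℓx : (ℓ : ℝ) = 2 * p * (n - x) := by rw [hx]; field_simp; ring
  have hquad : p * x ^ 2 - p ≤ 2 * p * n * j - p * (j : ℝ) ^ 2 - ℓ * j := by
    have h1 : (x - j) ^ 2 ≤ 1 := by nlinarith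
    have h2 := mul_le_mul_of_nonneg_left h1 hp.le
    rw [hℓx]
    linarith
  rcases le_or_gt (Fintype.card V) (j + (φ.dirty (φ.τ ℓ)).card) with hcase | hcase
  · have h1 := φ.le_T_of_dirty hG hp hjn hcase
    rw [← hn] at h1
    have h2 : (levelCurve κ * (p * n) - 1) ^ 2 / (4 * p) ≤ (ℓ : ℝ) ^ 2 / (4 * p) := by
      gcongr <;> linarith
    have h3 : (ℓ : ℝ) ^ 2 / (4 * p) = p * x ^ 2 + ℓ * n - p * n ^ 2 := by
      rw [hℓx]; field_simp; ring
    linarith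
  -- More than `j` clean vertices at time `τ ℓ` would need height about `p x ^ 2`, beyond the
  -- limiting curve by more than all error terms, by `herr`.
  · exfalso
    obtain ⟨κ', h1, h2, h3, h4⟩ := φ.S_le_heightCurve hG hp hκ hκ1 hceil hℓ1
    rw [← hn] at h3 h4
    have h5 := φ.le_S_of_clean hp (ℓ := ℓ) (φ.τ_le ℓ) hcase.le
    rw [← hn] at h5
    have h6 : p * x ^ 2 - p * n ^ 2 * heightCurve κ' =
        p * n ^ 2 * (κ' - levelCurve κ' / 2) ^ 2 := by
      have e : x = n * (1 - levelCurve κ' / 2) := by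
        rw [hx, ← h3]; field_simp
      rw [← sq_sub_heightCurve, e]; ring
    have h7 : (κ - levelCurve κ / 2) ^ 2 ≤ (κ' - levelCurve κ' / 2) ^ 2 := by
      have h8 : levelCurve κ' ≤ levelCurve κ :=
        (levelCurve_strictAntiOn hκ).antitoneOn ⟨le_rfl, hκ1⟩ ⟨h1, h2⟩ h1
      gcongr
      linarith
    have h8 := mul_le_mul_of_nonneg_left h7 (by positivity : 0 ≤ p * n ^ 2)
    have h9 : p * n ≤ ⌈p * n⌉₊ := Nat.le_ceil _
    have h10 : 2 * n * (1 - κ') ≤ 2 * n := by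
      have := half_lt_of_exp_lt (hκ.trans_le h1)
      nlinarith
    have h11 : 2 * p * j ≤ 2 * p * n := by gcongr; linarith
    linarith

end Lower

end Brushing

namespace Brushing

/-! ### The cut bound for random graphs -/

section Chernoff

open MeasureTheory unitInterval

variable {V : Type*} [Fintype V] [DecidableEq V]

open Classical in
/-- The pairs that may be edges. -/
noncomputable def offDiag (V : Type*) [Fintype V] : Finset (Sym2 V) :=
  Finset.univ.filter fun e => ¬ e.IsDiag

open Classical in
/-- The edges of a graph as a finset. -/
noncomputable def edges (G : SimpleGraph V) : Finset (Sym2 V) :=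
  Finset.univ.filter (· ∈ G.edgeSet)

theorem edges_subset (G : SimpleGraph V) : edges G ⊆ offDiag V := by
  intro e he
  simp only [edges, offDiag, Finset.mem_filter, Finset.mem_univ, true_and] at he ⊢
  exact G.not_isDiag_of_mem_edgeSet he

theorem card_offDiag : (offDiag V).card = (Fintype.card V).choose 2 := by
  classical
  rw [← Sym2.card_diagSet_compl, offDiag, ← Fintype.card_subtype]
  exact Fintype.card_congr (Equiv.refl _)

theorem binomialRandom_real_singleton (p : I) (G : SimpleGraph V) :
    (SimpleGraph.binomialRandom V p).real {G} =
      (p : ℝ) ^ (edges G).card * (1 - p : ℝ) ^ (offDiag V \ edges G).card := by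
  classical
  have h1 : G.edgeSet.ncard = (edges G).card := by
    rw [← Set.ncard_coe_finset]
    congr 1
    ext e; simp [edges]
  rw [measureReal_def, SimpleGraph.binomialRandom_singleton, h1,
    Finset.card_sdiff_of_subset (edges_subset G), card_offDiag, Nat.card_eq_fintype_card]
  simp

/-- Independence of the edges: graphs correspond to subsets of `offDiag V`, and the expectation of a
product over the edges is the expansion of a product of sums. -/
theorem sum_binomialRandom_mul_prod (p : I) (x : Sym2 V → ℝ) :
    ∑ G : SimpleGraph V, (SimpleGraph.binomialRandom V p).real {G} * ∏ e ∈ edges G, x e =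
      ∏ e ∈ offDiag V, ((p : ℝ) * x e + (1 - p)) := by
  classical
  rw [Finset.prod_add]
  refine Finset.sum_nbij' (fun G => edges G)
    (fun t => SimpleGraph.fromEdgeSet (t : Set (Sym2 V))) ?_ ?_ ?_ ?_ ?_
  · intro G _; exact Finset.mem_powerset.2 (edges_subset G)
  · intro t _; exact Finset.mem_univ _
  · intro G _
    have : ((edges G : Finset (Sym2 V)) : Set (Sym2 V)) = G.edgeSet := by ext e; simp [edges]
    rw [this, SimpleGraph.fromEdgeSet_edgeSet]
  · intro t ht
    ext e
    have := Finset.mem_powerset.1 ht (x := e)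
    simp only [offDiag, Finset.mem_filter, Finset.mem_univ, true_and] at this
    simp only [edges, SimpleGraph.edgeSet_fromEdgeSet, Finset.mem_filter, Finset.mem_univ,
      true_and, Set.mem_sdiff, Finset.mem_coe, Sym2.mem_diagSet]
    tauto
  · intro G _
    rw [binomialRandom_real_singleton, Finset.prod_mul_distrib, Finset.prod_const,
      Finset.prod_const]
    ring

/-- The number of times that `e` is counted among the pairs in `S × T`. -/
def pairCount (S T : Finset V) (e : Sym2 V) : ℕ :=
  ((S ×ˢ T).filter fun x => s(x.1, x.2) = e).card

theorem pairCount_le_two (S T : Finset V) (e : Sym2 V) : pairCount S T e ≤ 2 := by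
  induction e with
  | _ a b =>
    have : (S ×ˢ T).filter (fun x => s(x.1, x.2) = s(a, b)) ⊆ {(a, b), (b, a)} := by
      rintro ⟨x, y⟩ hx
      have := (Finset.mem_filter.1 hx).2
      simp only [Sym2.eq_iff] at this
      simp only [Finset.mem_insert, Finset.mem_singleton, Prod.mk.injEq]
      exact this
    exact (Finset.card_le_card this).trans Finset.card_le_two

theorem sum_nbrs_eq (G : SimpleGraph V) (S T : Finset V) :
    ∑ v ∈ S, nbrs G T v = ∑ e ∈ edges G, pairCount S T e := by
  classical
  have h1 : ∑ v ∈ S, nbrs G T v = ((S ×ˢ T).filter fun x => G.Adj x.1 x.2).card := by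
    simp only [nbrs, Finset.card_filter, Finset.sum_product]
  rw [h1, Finset.card_eq_sum_card_fiberwise (f := fun x : V × V => s(x.1, x.2)) (t := edges G)]
  · refine Finset.sum_congr rfl fun e he => ?_
    unfold pairCount
    rw [Finset.filter_filter]
    congr 1
    ext x
    simp only [Finset.mem_filter, and_congr_right_iff, and_iff_right_iff_imp]
    rintro - rfl
    simpa [edges] using he
  · intro x hx
    simpa [edges] using (Finset.mem_filter.1 (Finset.mem_coe.1 hx)).2

theorem sum_pairCount (S T : Finset V) :
    ∑ e ∈ offDiag V, pairCount S T e + (S ∩ T).card = S.card * T.card := by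
  classical
  have h1 : ∑ e ∈ offDiag V, pairCount S T e =
      ((S ×ˢ T).filter fun x => x.1 ≠ x.2).card := by
    rw [Finset.card_eq_sum_card_fiberwise (f := fun x : V × V => s(x.1, x.2)) (t := offDiag V)]
    · refine Finset.sum_congr rfl fun e he => ?_
      unfold pairCount
      rw [Finset.filter_filter]
      congr 1
      ext x
      simp only [Finset.mem_filter, and_congr_right_iff, ne_eq, iff_and_self]
      rintro - rfl
      simpa [offDiag] using he
    · intro x hx
      simpa [offDiag] using (Finset.mem_filter.1 (Finset.mem_coe.1 hx)).2
  have h2 : ((S ×ˢ T).filter fun x => x.1 = x.2).card = (S ∩ T).card := by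
    refine Finset.card_nbij' (fun x => x.1) (fun v => (v, v)) ?_ ?_ ?_ ?_
    · rintro ⟨a, b⟩ h
      simp only [Finset.coe_filter, Finset.mem_product, Set.mem_ofPred_eq] at h
      obtain ⟨⟨h1, h2⟩, rfl⟩ := h
      simp [h1, h2]
    · intro v hv
      simpa using hv
    · rintro ⟨a, b⟩ h
      simp only [Finset.coe_filter, Finset.mem_product, Set.mem_ofPred_eq] at h
      simp [h.2]
    · intro v _; rfl
  have h3 := Finset.card_filter_add_card_filter_not (s := S ×ˢ T) (fun x => x.1 = x.2)
  rw [Finset.card_product] at h3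
  rw [h1, ← h2]
  simp only [ne_eq]
  omega

/-- As `|θ c| ≤ 1`, one has `exp (θ c) ≤ 1 + θ c + (θ c) ^ 2`. The factor `4` comes from `c ≤ 2`, an
edge inside `S ∩ T` being counted in both directions. -/
theorem exp_moment_factor_le {p θ : ℝ} (hp : 0 ≤ p) (hθ : |θ| ≤ 1 / 2) {c : ℕ}
    (hc : c ≤ 2) :
    p * Real.exp (θ * c) + (1 - p) ≤ Real.exp (p * (θ * c) + 4 * p * θ ^ 2) := by
  have hc' : (c : ℝ) ≤ 2 := by exact_mod_cast hc
  have hc0 : (0 : ℝ) ≤ c := by positivity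
  have h1 : |θ * c| ≤ 1 := by
    rw [abs_mul, abs_of_nonneg hc0]
    nlinarith [abs_nonneg θ]
  have h2 := (abs_le.1 (Real.abs_exp_sub_one_sub_id_le h1)).2
  have h3 : (θ * c) ^ 2 ≤ 4 * θ ^ 2 := by
    rw [mul_pow]
    have : (c : ℝ) ^ 2 ≤ 4 := by nlinarith
    nlinarith [sq_nonneg θ]
  have h4 := Real.add_one_le_exp (p * (θ * c) + 4 * p * θ ^ 2)
  nlinarith

/-- The exponential Markov inequality; the sign of `θ` selects the upper or the lower tail. -/
theorem exp_moment_le (p : I) {θ : ℝ} (hθ : |θ| ≤ 1 / 2) (S T : Finset V) (A : Set (SimpleGraph V))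
    {b : ℝ} (hA : ∀ G ∈ A, b ≤ θ * (∑ v ∈ S, (nbrs G T v : ℝ) -
      p * ∑ e ∈ offDiag V, (pairCount S T e : ℝ))) :
    (SimpleGraph.binomialRandom V p).real A ≤
      Real.exp (4 * p * θ ^ 2 * (Fintype.card V : ℝ) ^ 2 - b) := by
  classical
  set μ := SimpleGraph.binomialRandom V p with hμ
  set c : Sym2 V → ℝ := fun e => (pairCount S T e : ℝ) with hc
  have hp0 : (0 : ℝ) ≤ p := p.2.1
  set d := p * ∑ e ∈ offDiag V, c e with hd
  have hprod : ∀ G : SimpleGraph V, ∏ e ∈ edges G, Real.exp (θ * c e) =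
      Real.exp (θ * ∑ v ∈ S, (nbrs G T v : ℝ)) := by
    intro G
    rw [← Real.exp_sum, ← Finset.mul_sum]
    congr 2
    simp only [hc]
    exact_mod_cast (sum_nbrs_eq G S T).symm
  have h1 : μ.real A ≤ ∑ G : SimpleGraph V, μ.real {G} * Real.exp
      (θ * ∑ v ∈ S, (nbrs G T v : ℝ) - θ * d - b) := by
    calc μ.real A ≤ μ.real (⋃ G ∈ Finset.univ.filter (· ∈ A), {G}) := by
          refine measureReal_mono ?_ (measure_ne_top _ _)
          intro G hG
          simp [hG]
      _ ≤ ∑ G ∈ Finset.univ.filter (· ∈ A), μ.real {G} := measureReal_biUnion_finset_le _ _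
      _ ≤ ∑ G ∈ Finset.univ.filter (· ∈ A), μ.real {G} * Real.exp
          (θ * ∑ v ∈ S, (nbrs G T v : ℝ) - θ * d - b) := by
          refine Finset.sum_le_sum fun G hG => ?_
          have h2 := hA G (Finset.mem_filter.1 hG).2
          refine le_mul_of_one_le_right measureReal_nonneg (Real.one_le_exp ?_)
          linarith
      _ ≤ _ := Finset.sum_le_sum_of_subset_of_nonneg (Finset.subset_univ _) fun _ _ _ => by
          positivity
  have h2 : ∑ G : SimpleGraph V, μ.real {G} * Real.exp
      (θ * ∑ v ∈ S, (nbrs G T v : ℝ) - θ * d - b) =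
      (∏ e ∈ offDiag V, ((p : ℝ) * Real.exp (θ * c e) + (1 - p))) * Real.exp (- θ * d - b) := by
    rw [← sum_binomialRandom_mul_prod, Finset.sum_mul]
    refine Finset.sum_congr rfl fun G _ => ?_
    rw [hprod, mul_assoc, ← Real.exp_add]
    congr 2
    ring
  have hpos : ∀ e ∈ offDiag V, 0 ≤ (p : ℝ) * Real.exp (θ * c e) + (1 - p) := fun e _ =>
    add_nonneg (by positivity) (by linarith [p.2.2])
  have h3 : ∏ e ∈ offDiag V, ((p : ℝ) * Real.exp (θ * c e) + (1 - p)) ≤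
      Real.exp (θ * d + (offDiag V).card * (4 * p * θ ^ 2)) := by
    calc _ ≤ ∏ e ∈ offDiag V, Real.exp (p * (θ * c e) + 4 * p * θ ^ 2) :=
          Finset.prod_le_prod hpos fun e _ =>
            exp_moment_factor_le hp0 hθ (pairCount_le_two S T e)
      _ = _ := by
          rw [← Real.exp_sum, Finset.sum_add_distrib, Finset.sum_const, nsmul_eq_mul,
            ← Finset.mul_sum, ← Finset.mul_sum, hd]
          congr 1
          ring
  have h4 : ((offDiag V).card : ℝ) ≤ (Fintype.card V : ℝ) ^ 2 := by
    rw [card_offDiag]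
    have : (Fintype.card V).choose 2 ≤ (Fintype.card V) ^ 2 := Nat.choose_le_pow _ _
    exact_mod_cast this
  calc μ.real A ≤ _ := h1
    _ = _ := h2
    _ ≤ Real.exp (θ * d + (offDiag V).card * (4 * p * θ ^ 2)) * Real.exp (- θ * d - b) := by
        gcongr
    _ = Real.exp ((offDiag V).card * (4 * p * θ ^ 2) - b) := by
        rw [← Real.exp_add]; congr 1; ring
    _ ≤ _ := by
        rw [Real.exp_le_exp]
        have : ((offDiag V).card : ℝ) * (4 * p * θ ^ 2) ≤
            (Fintype.card V : ℝ) ^ 2 * (4 * p * θ ^ 2) := by gcongr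
        linarith

/-- A random graph satisfies the cut bound with high probability. -/
theorem binomialRandom_not_cutBound_le (p : I) {δ : ℝ} (hδ : 0 < δ) (hδ1 : δ ≤ 1) :
    (SimpleGraph.binomialRandom V p).real {G | ¬ CutBound G p
      (δ * (p * (Fintype.card V : ℝ) ^ 2) + p * Fintype.card V)} ≤
      2 * 4 ^ Fintype.card V * Real.exp (-(δ ^ 2 * (p * (Fintype.card V : ℝ) ^ 2) / 16)) := by
  classical
  set n : ℝ := (Fintype.card V : ℝ) with hn
  have hp0 : (0 : ℝ) ≤ p := p.2.1
  let dev : Finset V × Finset V → SimpleGraph V → ℝ := fun x G =>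
    ∑ v ∈ x.1, (nbrs G x.2 v : ℝ) - p * ∑ e ∈ offDiag V, (pairCount x.1 x.2 e : ℝ)
  let A : Finset V × Finset V → Set (SimpleGraph V) := fun x =>
    {G | δ * (p * n ^ 2) ≤ dev x G} ∪ {G | δ * (p * n ^ 2) ≤ -dev x G}
  have hsub : {G | ¬ CutBound G p (δ * (p * n ^ 2) + p * n)} ⊆
      ⋃ x ∈ (Finset.univ : Finset (Finset V × Finset V)), A x := by
    intro G hG
    by_contra hcon
    simp only [A, Set.mem_iUnion, Set.mem_union, Set.mem_ofPred_eq, not_exists, not_or,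
      not_le] at hcon
    refine hG fun S T => ?_
    obtain ⟨h1, h2⟩ := hcon (S, T) (Finset.mem_univ _)
    have h3 : ∑ e ∈ offDiag V, (pairCount S T e : ℝ) + (S ∩ T).card = S.card * T.card := by
      exact_mod_cast sum_pairCount S T
    have h4 : ((S ∩ T).card : ℝ) ≤ n := by
      rw [hn]; exact_mod_cast Finset.card_le_univ _
    have h5 : p * ((S ∩ T).card : ℝ) ≤ p * n := by gcongr
    have h6 : 0 ≤ p * ((S ∩ T).card : ℝ) := by positivity
    simp only [dev] at h1 h2
    have e : (p : ℝ) * S.card * T.card = p * ∑ e ∈ offDiag V, (pairCount S T e : ℝ) +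
        p * (S ∩ T).card := by rw [mul_assoc, ← h3]; ring
    rw [e, abs_le]
    constructor <;> linarith
  have hA : ∀ x, (SimpleGraph.binomialRandom V p).real (A x) ≤
      2 * Real.exp (-(δ ^ 2 * (p * n ^ 2) / 16)) := by
    intro x
    -- The choice `θ = δ / 8` minimizes `4 p θ ^ 2 n ^ 2 - θ δ p n ^ 2`.
    have hθ : |δ / 8| ≤ 1 / 2 := by rw [abs_of_pos (by positivity)]; linarith
    have hθ' : |-(δ / 8)| ≤ 1 / 2 := by rwa [abs_neg]
    have h1 := exp_moment_le p hθ x.1 x.2 {G | δ * (p * n ^ 2) ≤ dev x G}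
      (b := δ / 8 * (δ * (p * n ^ 2))) fun G hG =>
        mul_le_mul_of_nonneg_left hG (by positivity)
    have h2 := exp_moment_le p hθ' x.1 x.2 {G | δ * (p * n ^ 2) ≤ -dev x G}
      (b := δ / 8 * (δ * (p * n ^ 2))) fun G hG => by
        have := mul_le_mul_of_nonneg_left hG (by positivity : 0 ≤ δ / 8)
        simp only [dev] at this
        linarith
    have e1 : 4 * p * (δ / 8) ^ 2 * (Fintype.card V : ℝ) ^ 2 - δ / 8 * (δ * (p * n ^ 2)) =
        -(δ ^ 2 * (p * n ^ 2) / 16) := by rw [← hn]; ring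
    have e2 : 4 * p * (-(δ / 8)) ^ 2 * (Fintype.card V : ℝ) ^ 2 - δ / 8 * (δ * (p * n ^ 2)) =
        -(δ ^ 2 * (p * n ^ 2) / 16) := by rw [← hn]; ring
    rw [e1] at h1
    rw [e2] at h2
    have := measureReal_union_le (μ := SimpleGraph.binomialRandom V p)
      {G | δ * (p * n ^ 2) ≤ dev x G} {G | δ * (p * n ^ 2) ≤ -dev x G}
    simp only [A]
    linarith
  calc _ ≤ (SimpleGraph.binomialRandom V p).real
        (⋃ x ∈ (Finset.univ : Finset (Finset V × Finset V)), A x) :=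
          measureReal_mono hsub (measure_ne_top _ _)
    _ ≤ ∑ x : Finset V × Finset V, (SimpleGraph.binomialRandom V p).real (A x) :=
        measureReal_biUnion_finset_le _ _
    _ ≤ ∑ x : Finset V × Finset V, 2 * Real.exp (-(δ ^ 2 * (p * n ^ 2) / 16)) :=
        Finset.sum_le_sum fun x _ => hA x
    _ = _ := by
        rw [Finset.sum_const, Finset.card_univ, Fintype.card_prod, Fintype.card_finset,
          nsmul_eq_mul, ← mul_pow]
        push_cast
        ring

end Chernoff

end Brushing

namespace Brushing

/-! ### Choice of parameters -/

section Deterministic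

open Real

theorem CutBound.mono {V : Type*} {G : SimpleGraph V} {p Δ Δ' : ℝ} (h : CutBound G p Δ)
    (hΔ : Δ ≤ Δ') : CutBound G p Δ' := fun S T => (h S T).trans hΔ

/-- At `κ = exp (-1/2)` the value of `λ ^ 2 / 4` is exactly `exp (-1)`, but there the gap `κ - λ /
2` is zero. Continuity gives a slightly larger `κ` with a positive gap. -/
theorem exists_levelCurve_near {ε : ℝ} (hε : 0 < ε) :
    ∃ κ, exp (-(1 / 2)) < κ ∧ κ < 1 ∧ exp (-1) - ε < levelCurve κ ^ 2 / 4 := by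
  have h0 : (0 : ℝ) < exp (-(1 / 2)) := exp_pos _
  have h1 : exp (-(1 / 2)) < 1 := by rw [exp_lt_one_iff]; norm_num
  have hval : levelCurve (exp (-(1 / 2))) ^ 2 / 4 = exp (-1) := by
    have e : exp (-1) = exp (-(1 / 2)) * exp (-(1 / 2)) := by rw [← exp_add]; norm_num
    unfold levelCurve
    rw [log_exp, e]; ring
  have hc : ContinuousAt (fun κ => levelCurve κ ^ 2 / 4) (exp (-(1 / 2))) :=
    ((hasDerivAt_levelCurve h0).continuousAt.pow 2).div_const 4
  have hev := hc.eventually (lt_mem_nhds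
    (show exp (-1) - ε < levelCurve (exp (-(1 / 2))) ^ 2 / 4 by rw [hval]; linarith))
  have hev2 := (hev.filter_mono (nhdsWithin_le_nhds (s := Set.Ioi (exp (-(1 / 2)))))).and
    (Ioo_mem_nhdsGT h1)
  obtain ⟨κ, hκ, hκ'⟩ := hev2.exists
  exact ⟨κ, hκ'.1, hκ'.2, hκ⟩

set_option maxHeartbeats 800000 in
/-- The game brush number of a dense enough graph with a good cut bound is about `p n² / e`. -/
theorem exists_gameBrushNumber_near {ε : ℝ} (hε : 0 < ε) :
    ∃ δ > 0, ∃ K : ℝ, ∀ {V : Type} [Fintype V] [DecidableEq V] (G : SimpleGraph V) (p : ℝ),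
      0 < p → p ≤ 1 → K ≤ p * Fintype.card V →
      CutBound G p (δ * (p * (Fintype.card V : ℝ) ^ 2)) →
      |(gameBrushNumber G : ℝ) - p * (Fintype.card V : ℝ) ^ 2 * exp (-1)| ≤
        ε * (p * (Fintype.card V : ℝ) ^ 2) := by
  obtain ⟨κ, hκ, hκ1, hκe⟩ := exists_levelCurve_near (half_pos hε)
  have hlam1 : 1 < levelCurve κ := by
    rw [← levelCurve_one]
    exact levelCurve_strictAntiOn hκ ⟨le_rfl, hκ1.le⟩ ⟨hκ1.le, le_rfl⟩ hκ1
  have hlam2 : levelCurve κ < 2 * κ := levelCurve_lt hκ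
  have hγ : 0 < (κ - levelCurve κ / 2) ^ 2 := by
    have : 0 < κ - levelCurve κ / 2 := by linarith
    positivity
  set l := levelCurve κ with hl
  set γ := (κ - l / 2) ^ 2 with hγdef
  set η := min γ ε with hη
  have hη0 : 0 < η := lt_min hγ hε
  have hηγ : η ≤ γ := min_le_left _ _
  have hηε : η ≤ ε := min_le_right _ _
  -- Blocks of about `n / M` vertices give errors of order `p n ^ 2 / M`, and `M` cuts give errors
  -- `M δ p n ^ 2`. With `δ = η / (80 M)` both are small multiples of `η p n ^ 2`, below the
  -- tolerance `ε` and the gap `γ`.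
  obtain ⟨M, hM⟩ := exists_nat_gt (128 / η)
  have hM0' : (0 : ℝ) < M := (by positivity : (0 : ℝ) < 128 / η).trans hM
  have hM0 : 0 < M := by exact_mod_cast hM0'
  have hM1 : (1 : ℝ) ≤ M := by exact_mod_cast hM0
  have hMη : 128 * (1 / M) ≤ η := by
    rw [div_lt_iff₀ hη0] at hM
    rw [mul_one_div, div_le_iff₀ hM0']
    linarith
  set δ := η / (80 * M) with hδ
  have hδ0 : 0 < δ := by positivity
  have hMδ : M * δ = η / 80 := by rw [hδ]; field_simp
  have hδM : δ ≤ M * δ := le_mul_of_one_le_left hδ0.le hM1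
  -- The three bounds on `p n` absorb the terms linear in `n`, leave an integer level between `p n`
  -- and `l p n`, and make the block size at least one.
  refine ⟨δ, hδ0, max (80 / η) (max (2 / (l - 1)) (2 * M ^ 2)), ?_⟩
  intro V _ _ G p hp hp1 hK hG
  have hK1 : 80 / η ≤ p * Fintype.card V := (le_max_left _ _).trans hK
  have hK2 : 2 / (l - 1) ≤ p * Fintype.card V :=
    (le_max_left _ _).trans ((le_max_right _ _).trans hK)
  have hK3 : 2 * (M : ℝ) ^ 2 ≤ p * Fintype.card V :=
    (le_max_right _ _).trans ((le_max_right _ _).trans hK)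
  set n : ℝ := (Fintype.card V : ℝ) with hn
  have hpn : p * n ≤ n := mul_le_of_le_one_left (by positivity) hp1
  have hnM : 2 * (M : ℝ) ^ 2 ≤ n := hK3.trans hpn
  have hM2 : (M : ℝ) ≤ M ^ 2 := by nlinarith
  have hn1 : 1 ≤ n := by linarith
  have hcard : 0 < Fintype.card V := by
    have : (0 : ℝ) < Fintype.card V := by linarith
    exact_mod_cast this
  have : Nonempty V := Fintype.card_pos_iff.1 hcard
  set N := p * n ^ 2 with hN
  have hNn : n * (80 / η) ≤ N := by
    calc n * (80 / η) ≤ n * (p * n) := by gcongr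
      _ = N := by rw [hN]; ring
  have hnη : 80 * n ≤ η * N := by
    have := mul_le_mul_of_nonneg_left hNn hη0.le
    have e : η * (n * (80 / η)) = 80 * n := by field_simp
    linarith
  have hN0 : 0 < N := by positivity
  have hNM : 2 * (M : ℝ) ^ 2 ≤ N := by
    calc 2 * (M : ℝ) ^ 2 ≤ 1 * (p * n) := by linarith
      _ ≤ n * (p * n) := by gcongr
      _ = N := by rw [hN]; ring
  have hq0 : 0 < n / M := by positivity
  have hqM : n / M * M = n := by field_simp
  have hpq : p * (n / M) ^ 2 * M = N * (1 / M) := by rw [hN]; field_simp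
  have hMq : (M : ℝ) ≤ n / M := by rw [le_div_iff₀ hM0']; nlinarith
  set m₀ := ⌊n / M⌋₊ with hm₀
  have hm₀1 : (m₀ : ℝ) ≤ n / M := Nat.floor_le hq0.le
  have hm₀2 : n / M < m₀ + 1 := Nat.lt_floor_add_one _
  have hm₀0 : 0 < m₀ := Nat.floor_pos.2 (hM1.trans hMq)
  have h1M : N * (1 / M) ≤ N * (η / 128) := mul_le_mul_of_nonneg_left (by linarith) hN0.le
  rw [abs_le]
  constructor
  -- The block size is rounded up here because the blocks must cover the whole order. In the upper
  -- bound it is rounded down because the phases must fit.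
  · have hmM : Fintype.card V ≤ M * (m₀ + 1) := by
      have : (Fintype.card V : ℝ) ≤ M * (m₀ + 1) := by
        rw [← hn, ← hqM, mul_comm]; gcongr
      exact_mod_cast this
    have hErr : (M : ℝ) * (3 * (δ * N) + 2 * p * ((m₀ + 1 : ℕ) : ℝ) ^ 2) ≤
        3 * (M * δ) * N + 8 * (N * (1 / M)) := by
      have h1 : ((m₀ + 1 : ℕ) : ℝ) ≤ 2 * (n / M) := by push_cast; linarith
      calc (M : ℝ) * (3 * (δ * N) + 2 * p * ((m₀ + 1 : ℕ) : ℝ) ^ 2) ≤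
          M * (3 * (δ * N) + 2 * p * (2 * (n / M)) ^ 2) := by gcongr
        _ = 3 * (M * δ) * N + 8 * (p * (n / M) ^ 2 * M) := by ring
        _ = _ := by rw [hpq]
    have hErr' : (M : ℝ) * (3 * (δ * N) + 2 * p * ((m₀ + 1 : ℕ) : ℝ) ^ 2) ≤ η * N / 8 := by
      rw [hMδ] at hErr
      have : 0 < η * N := by positivity
      linarith
    have hδN : δ * N ≤ η * N / 80 := by
      have : δ * N ≤ M * δ * N := by gcongr
      rw [hMδ] at this
      linarith
    have hlow := le_gameBrushNumber (κ := κ) hG hp (Nat.succ_pos m₀) hmM hκ hκ1.le ?_ ?_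
    · rw [← hn, ← hl] at hlow
      have h2 : (l * (p * n) - 1) ^ 2 / (4 * p) = l ^ 2 / 4 * N - l * n / 2 + 1 / (4 * p) := by
        rw [hN]; field_simp; ring
      have h3 : 0 ≤ 1 / (4 * p) := by positivity
      have h4 : (exp (-1) - ε / 2) * N ≤ l ^ 2 / 4 * N := by gcongr
      have h5 : l * n ≤ 2 * n := by gcongr; linarith
      have h6 : η * N ≤ ε * N := by gcongr
      have e : ((m₀.succ : ℕ) : ℝ) = ((m₀ + 1 : ℕ) : ℝ) := rfl
      rw [e] at hlow
      have h7 : 0 < η * N := by positivity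
      linarith
    · rw [← hn, ← hl]
      rw [div_le_iff₀ (by linarith)] at hK2
      linarith
    · rw [← hn, ← hl, ← hγdef]
      have h6 : η * N ≤ γ * N := by gcongr
      have e : ((m₀.succ : ℕ) : ℝ) = ((m₀ + 1 : ℕ) : ℝ) := rfl
      rw [e]
      have h7 : 0 < η * N := by positivity
      linarith
  · have hmM : M * m₀ ≤ Fintype.card V := by
      have : (M * m₀ : ℝ) ≤ Fintype.card V := by
        rw [← hn, ← hqM, mul_comm]; gcongr
      exact_mod_cast this
    have hup := gameBrushNumber_le hG hp hm₀0 hM0 hmM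
    rw [← hn] at hup
    have h1 : (M : ℝ) * (26 * p * m₀ ^ 2 + 20 * (δ * N) + 2) ≤
        26 * (N * (1 / M)) + 20 * (M * δ) * N + 2 * M := by
      calc (M : ℝ) * (26 * p * m₀ ^ 2 + 20 * (δ * N) + 2) ≤
          M * (26 * p * (n / M) ^ 2 + 20 * (δ * N) + 2) := by gcongr
        _ = 26 * (p * (n / M) ^ 2 * M) + 20 * (M * δ) * N + 2 * M := by ring
        _ = _ := by rw [hpq]
    have h2 : 2 * p * (n - (M - 1) * m₀) ^ 2 ≤ 8 * (N * (1 / M)) := by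
      have h3 : n - (M - 1) * m₀ ≤ 2 * (n / M) := by
        have h4 : ((M : ℝ) - 1) * (n / M - 1) ≤ (M - 1) * m₀ := by
          have : (0 : ℝ) ≤ M - 1 := by linarith
          gcongr; linarith
        linarith
      have h5 : 0 ≤ n - (M - 1) * m₀ := by
        have : ((M : ℝ) - 1) * m₀ ≤ M * (n / M) := by gcongr; linarith
        linarith
      calc 2 * p * (n - (M - 1) * m₀) ^ 2 ≤ 2 * p * (2 * (n / M)) ^ 2 := by gcongr
        _ = 8 * (p * (n / M) ^ 2 * 1) := by ring
        _ ≤ 8 * (p * (n / M) ^ 2 * M) := by gcongr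
        _ = _ := by rw [hpq]
    have h3 : 2 * (M : ℝ) ≤ N * (1 / M) := by
      rw [mul_one_div, le_div_iff₀ hM0']; linarith
    have hδN : δ * N ≤ η * N / 80 := by
      have : δ * N ≤ M * δ * N := by gcongr
      rw [hMδ] at this
      linarith
    rw [hMδ] at h1
    have h6 : η * N ≤ ε * N := by gcongr
    have h7 : 0 < η * N := by positivity
    linarith

end Deterministic

/-! ### Complete and random graphs -/

section Random

open Filter Topology MeasureTheory

theorem tendsto_mul_of_isLittleO {p : ℕ → unitInterval}
    (hp : Asymptotics.IsLittleO atTop (fun n : ℕ => Real.log n / n) (fun n : ℕ => (p n : ℝ))) :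
    Tendsto (fun n : ℕ => (p n : ℝ) * n) atTop atTop := by
  refine tendsto_atTop_mono' _ ?_ (Real.tendsto_log_atTop.comp tendsto_natCast_atTop_atTop)
  filter_upwards [hp.def one_pos, eventually_gt_atTop 0] with n hn hn0
  have hn0' : (0 : ℝ) < n := by exact_mod_cast hn0
  rw [one_mul, Real.norm_of_nonneg (p n).2.1] at hn
  have := (le_abs_self _).trans hn
  rwa [div_le_iff₀ hn0'] at this

/-- The game brush number of the complete graph. -/
theorem eventually_gameBrushNumber_top {ε : ℝ} (hε : 0 < ε) : ∀ᶠ n : ℕ in atTop,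
    |(gameBrushNumber (⊤ : SimpleGraph (Fin n)) : ℝ) - (n : ℝ) ^ 2 * Real.exp (-1)| ≤
      ε * (n : ℝ) ^ 2 := by
  obtain ⟨δ, hδ, K, h⟩ := exists_gameBrushNumber_near hε
  filter_upwards [eventually_gt_atTop 0, tendsto_natCast_atTop_atTop.eventually_ge_atTop K,
    tendsto_natCast_atTop_atTop.eventually_ge_atTop (1 / δ)] with n hn hK hδn
  have : NeZero n := ⟨hn.ne'⟩
  have hn0 : (0 : ℝ) < n := by exact_mod_cast hn
  have h1 := h (⊤ : SimpleGraph (Fin n)) 1 one_pos le_rfl (by simpa using hK)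
    (cutBound_top.mono ?_)
  · simpa using h1
  · rw [Fintype.card_fin, one_mul]
    rw [div_le_iff₀ hδ] at hδn
    nlinarith

theorem tendsto_gameBrushNumber_near {p : ℕ → unitInterval}
    (hp : Tendsto (fun n : ℕ => (p n : ℝ) * n) atTop atTop) {ε : ℝ} (hε : 0 < ε) :
    Tendsto (fun n : ℕ => (SimpleGraph.binomialRandom (Fin n) (p n)).real
      {G | |(gameBrushNumber G : ℝ) - p n * n ^ 2 * Real.exp (-1)| ≤ ε * (p n * n ^ 2)})
      atTop (𝓝 1) := by
  obtain ⟨δ₀, hδ₀, K, h⟩ := exists_gameBrushNumber_near hε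
  set δ := min (δ₀ / 2) 1 with hδ
  have hδ0 : 0 < δ := lt_min (half_pos hδ₀) one_pos
  have hlim : Tendsto (fun n : ℕ => 1 - 2 * Real.exp (-(n : ℝ))) atTop (𝓝 1) := by
    have h1 : Tendsto (fun n : ℕ => Real.exp (-(n : ℝ))) atTop (𝓝 0) :=
      (Real.tendsto_exp_neg_atTop_nhds_zero).comp tendsto_natCast_atTop_atTop
    simpa using (h1.const_mul 2).const_sub 1
  refine tendsto_of_tendsto_of_tendsto_of_le_of_le' hlim tendsto_const_nhds ?_
    (Eventually.of_forall fun n => measureReal_le_one)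
  -- The third condition makes the exponent `δ ^ 2 p n ^ 2 / 16` at least `n (log 4 + 1)`, which
  -- beats the `4 ^ n` pairs of sets and leaves `exp (-n)`.
  filter_upwards [hp.eventually_ge_atTop K, hp.eventually_ge_atTop 1,
    hp.eventually_ge_atTop (16 * (Real.log 4 + 1) / δ ^ 2),
    tendsto_natCast_atTop_atTop.eventually_ge_atTop (2 / δ₀)] with n hK h1 hlarge hn
  have hn0 : (0 : ℝ) < n := (by positivity : (0 : ℝ) < 2 / δ₀).trans_le hn
  have hp0 : (0 : ℝ) < p n := by
    by_contra hcon
    have : (p n : ℝ) * n ≤ 0 := mul_nonpos_of_nonpos_of_nonneg (not_lt.1 hcon) hn0.le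
    linarith
  set μ := SimpleGraph.binomialRandom (Fin n) (p n) with hμ
  set good := {G : SimpleGraph (Fin n) |
    |(gameBrushNumber G : ℝ) - p n * n ^ 2 * Real.exp (-1)| ≤ ε * (p n * n ^ 2)} with hgood
  set bad := {G : SimpleGraph (Fin n) | ¬ CutBound G (p n)
    (δ * (p n * (Fintype.card (Fin n) : ℝ) ^ 2) + p n * Fintype.card (Fin n))} with hbad
  have hunion : (Set.univ : Set (SimpleGraph (Fin n))) ⊆ good ∪ bad := by
    intro G _
    by_cases hG : G ∈ bad
    · exact Or.inr hG
    · refine Or.inl ?_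
      have hG' : CutBound G (p n)
        (δ * (p n * (Fintype.card (Fin n) : ℝ) ^ 2) + p n * Fintype.card (Fin n)) := by
        simpa [hbad] using hG
      have := h G (p n) hp0 (p n).2.2 (by simpa using hK) (hG'.mono ?_)
      · simpa [hgood] using this
      · rw [Fintype.card_fin]
        have h2 : δ * (p n * (n : ℝ) ^ 2) ≤ δ₀ / 2 * (p n * (n : ℝ) ^ 2) := by
          gcongr; exact min_le_left _ _
        have h3 : (p n : ℝ) * n ≤ δ₀ / 2 * (p n * (n : ℝ) ^ 2) := by
          rw [div_le_iff₀ hδ₀] at hn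
          have h4 : (p n : ℝ) * n * 2 ≤ p n * n * (n * δ₀) := by gcongr
          linarith
        linarith
  have hbadle : μ.real bad ≤ 2 * Real.exp (-(n : ℝ)) := by
    refine (binomialRandom_not_cutBound_le (V := Fin n) (p n) hδ0 (min_le_right _ _)).trans ?_
    rw [Fintype.card_fin, mul_assoc]
    gcongr
    have e4 : (4 : ℝ) ^ n = Real.exp (n * Real.log 4) := by
      rw [mul_comm, Real.exp_mul, Real.exp_log (by norm_num), Real.rpow_natCast]
    rw [e4, ← Real.exp_add, Real.exp_le_exp]
    rw [div_le_iff₀ (by positivity)] at hlarge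
    have := mul_le_mul_of_nonneg_left hlarge hn0.le
    linarith
  have htotal : (1 : ℝ) ≤ μ.real good + μ.real bad := by
    calc (1 : ℝ) = μ.real Set.univ := by simp [hμ]
      _ ≤ μ.real (good ∪ bad) := measureReal_mono hunion (measure_ne_top _ _)
      _ ≤ _ := measureReal_union_le _ _
  linarith

end Random

end Brushing

/-! ### The main theorem -/

theorem mainTheorem1 (p : ℕ → unitInterval)
    (hp : Asymptotics.IsLittleO Filter.atTop (fun n : ℕ => Real.log n / n)
      (fun n : ℕ => (p n : ℝ))) :
    (∀ ε : ℝ, 0 < ε →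
      Filter.Tendsto (fun n : ℕ => (SimpleGraph.binomialRandom (Fin n) (p n)).real
        {G : SimpleGraph (Fin n) |
          |(Brushing.gameBrushNumber G : ℝ) -
              p n * Brushing.gameBrushNumber (⊤ : SimpleGraph (Fin n))| ≤
            ε * (p n * Brushing.gameBrushNumber (⊤ : SimpleGraph (Fin n)))})
        Filter.atTop (nhds 1)) ∧
    Asymptotics.IsEquivalent Filter.atTop
      (fun n : ℕ => (p n : ℝ) * Brushing.gameBrushNumber (⊤ : SimpleGraph (Fin n)))
      (fun n : ℕ => (p n : ℝ) * n ^ 2 / Real.exp 1) ∧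
    (∀ ε : ℝ, 0 < ε →
      Filter.Tendsto (fun n : ℕ => (SimpleGraph.binomialRandom (Fin n) (p n)).real
        {G : SimpleGraph (Fin n) |
          |(Brushing.gameBrushNumber G : ℝ) - p n * n ^ 2 / Real.exp 1| ≤
            ε * (p n * n ^ 2 / Real.exp 1)})
        Filter.atTop (nhds 1)) := by
  have hpn := Brushing.tendsto_mul_of_isLittleO hp
  have he : ∀ n : ℕ, (p n : ℝ) * n ^ 2 / Real.exp 1 = p n * n ^ 2 * Real.exp (-1) := by
    intro n; rw [Real.exp_neg, div_eq_mul_inv]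
  have hrandom : ∀ ε : ℝ, 0 < ε →
      Filter.Tendsto (fun n : ℕ => (SimpleGraph.binomialRandom (Fin n) (p n)).real
        {G : SimpleGraph (Fin n) |
          |(Brushing.gameBrushNumber G : ℝ) - p n * n ^ 2 / Real.exp 1| ≤
            ε * (p n * n ^ 2 / Real.exp 1)})
        Filter.atTop (nhds 1) := by
    intro ε hε
    have h := Brushing.tendsto_gameBrushNumber_near hpn
      (mul_pos hε (Real.exp_pos (-1)))
    refine h.congr fun n => ?_
    congr 2
    ext G
    simp only [he]
    rw [show ε * Real.exp (-1) * ((p n : ℝ) * n ^ 2) = ε * (p n * n ^ 2 * Real.exp (-1)) by ring]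
  have htop : ∀ ε : ℝ, 0 < ε → ∀ᶠ n : ℕ in Filter.atTop,
      |(p n : ℝ) * Brushing.gameBrushNumber (⊤ : SimpleGraph (Fin n)) -
        p n * n ^ 2 / Real.exp 1| ≤ ε * (p n * n ^ 2 / Real.exp 1) := by
    intro ε hε
    filter_upwards [Brushing.eventually_gameBrushNumber_top
      (mul_pos hε (Real.exp_pos (-1)))] with n hn
    have h0 : (0 : ℝ) ≤ p n := (p n).2.1
    rw [he, mul_assoc, ← mul_sub, abs_mul, abs_of_nonneg h0]
    calc (p n : ℝ) * _ ≤ p n * (ε * Real.exp (-1) * (n : ℝ) ^ 2) := by gcongr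
      _ = _ := by ring
  refine ⟨fun ε hε => ?_, ?_, hrandom⟩
  -- Both quantities are within `ε₁ x` of `x = p n ^ 2 / e`, hence within `ε x / 2` of each other.
  -- Since `ε₁ ≤ 1 / 2`, the value for the complete graph times `p` is at least `x / 2`.
  · set ε₁ := min (ε / 4) (1 / 2) with hε₁
    have hε₁0 : 0 < ε₁ := lt_min (by linarith) (by norm_num)
    have h4 : ε₁ ≤ ε / 4 := min_le_left _ _
    have h2 : ε₁ ≤ 1 / 2 := min_le_right _ _
    refine tendsto_of_tendsto_of_tendsto_of_le_of_le' (hrandom ε₁ hε₁0) tendsto_const_nhds ?_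
      (Filter.Eventually.of_forall fun n => MeasureTheory.measureReal_le_one)
    filter_upwards [htop ε₁ hε₁0] with n hn
    refine MeasureTheory.measureReal_mono (fun G hG => ?_) (MeasureTheory.measure_ne_top _ _)
    simp only [Set.mem_ofPred_eq] at hG ⊢
    set x := (p n : ℝ) * n ^ 2 / Real.exp 1 with hx
    have hx0 : 0 ≤ x := by
      have h0 : (0 : ℝ) ≤ p n := (p n).2.1
      positivity
    rw [abs_le] at hG hn ⊢
    have h5 : ε₁ * x ≤ ε / 4 * x := by gcongr
    have h6 : ε₁ * x ≤ 1 / 2 * x := by gcongr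
    have h7 : ε * (1 / 2 * x) ≤
        ε * (p n * Brushing.gameBrushNumber (⊤ : SimpleGraph (Fin n))) := by
      exact mul_le_mul_of_nonneg_left (by linarith) hε.le
    constructor <;> linarith
  · rw [Asymptotics.IsEquivalent, Asymptotics.isLittleO_iff]
    intro ε hε
    filter_upwards [htop ε hε] with n hn
    have h0 : (0 : ℝ) ≤ p n * n ^ 2 / Real.exp 1 := by
      have h0 : (0 : ℝ) ≤ p n := (p n).2.1
      positivity
    rw [Pi.sub_apply, Real.norm_eq_abs, Real.norm_of_nonneg h0]
    exact hn
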